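/- Let $\mathcal H$ be a complex Hilbert space. An operator $A\in\mathcal B(\mathcal H)$ is a trace class operator if $\|A\|_{tr}=\operatorname{tr}|A|<\infty$, where $|A|=(A^*A)^{1/2}$. Let $\mathcal L$ be a Lie algebra of trace class operators on $\mathcal H$, i.e. a complex linear subspace of $\mathcal B(\mathcal H)$ that consists of trace class operators and satisfies $AB-BA\in\mathcal L$ for all $A,B\in\mathcal L$. Suppose that $\mathcal L$ is closed with respect to the trace norm (but not necessarily with respect to the operator norm). Then $\mathcal L$ is an Engel Lie algebra, or $\mathcal L$ contains a nonzero finite rank operator. Here $\mathcal L$ is called an Engel Lie algebra if, for every $A\in\mathcal L$, the operator $ad_{\mathcal L}(A)\colon \mathcal L\to\mathcal L$, $B\mapsto AB-BA$, is quasinilpotent, where $\mathcal L$ carries the operator norm. A bounded operator $T$ on a complex normed space $E$ is called quasinilpotent if its spectrum in the algebra $\mathcal B(E)$ of bounded operators on $E$ is contained in $\{0\}$ and $\lim_{n\to\infty}\|T^n\|^{1/n}=0$ (for complete $E$ these two conditions are equivalent). -/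

import Mathlib

attribute [local instance] LieRing.ofAssociativeRing

noncomputable section

namespace TraceClassLie

open scoped ENNReal InnerProductSpace Topology

section TraceNorm

variable {H : Type*} [NormedAddCommGroup H] [InnerProductSpace ℂ H] [CompleteSpace H]

/-- The sum `∑ ⟪|A| b i, b i⟫` over a Hilbert basis `b`, where `|A| = (A* A)^(1/2)`. Its terms are
nonnegative reals, so it is taken in `[0, ∞]`. -/
def absTraceAlong {ι : Type*} (b : HilbertBasis ι ℂ H) (A : H →L[ℂ] H) : ℝ≥0∞ :=
  ∑' i, ENNReal.ofReal (RCLike.re ⟪CFC.abs A (b i), b i⟫_ℂ)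

variable (H) in
/-- Some Hilbert basis of `H`; the choice does not matter (`traceNorm_eq`). -/
def someBasis : HilbertBasis (exists_hilbertBasis ℂ H).choose ℂ H :=
  (exists_hilbertBasis ℂ H).choose_spec.choose

/-- The trace norm `‖A‖_tr = tr |A|`, with values in `[0, ∞]`. -/
def traceNorm (A : H →L[ℂ] H) : ℝ≥0∞ :=
  absTraceAlong (someBasis H) A

/-- `A` is a trace class operator: `tr |A| < ∞`. -/
def IsTraceClass (A : H →L[ℂ] H) : Prop :=
  traceNorm A < ∞

theorem tsum_norm_sq {ι H : Type*} [NormedAddCommGroup H] [InnerProductSpace ℂ H]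
    (b : HilbertBasis ι ℂ H) (x : H) :
    ∑' i, ENNReal.ofReal (‖⟪b i, x⟫_ℂ‖ ^ 2) = ENNReal.ofReal (‖x‖ ^ 2) := by
  have h := Complex.hasSum_re (b.hasSum_inner_mul_inner x x)
  have e : ∀ i, (⟪x, b i⟫_ℂ * ⟪b i, x⟫_ℂ).re = ‖⟪b i, x⟫_ℂ‖ ^ 2 := fun i => by
    rw [← inner_conj_symm x (b i), ← Complex.normSq_eq_conj_mul_self, Complex.ofReal_re,
      Complex.normSq_eq_norm_sq]
  simp only [e] at h
  rw [← ENNReal.ofReal_tsum_of_nonneg (fun _ => sq_nonneg _) h.summable, h.tsum_eq]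
  congr 1
  exact (norm_sq_eq_re_inner (𝕜 := ℂ) x).symm

/-- The sum does not depend on the Hilbert basis. -/
theorem absTraceAlong_eq {ι κ : Type*} (b : HilbertBasis ι ℂ H) (c : HilbertBasis κ ℂ H)
    (A : H →L[ℂ] H) : absTraceAlong b A = absTraceAlong c A := by
  set S := CFC.sqrt (CFC.abs A) with hS
  have hSS : S * S = CFC.abs A := CFC.sqrt_mul_sqrt_self _ (CFC.abs_nonneg A)
  have hsa : (S : H →ₗ[ℂ] H).IsSymmetric :=
    ContinuousLinearMap.isSelfAdjoint_iff_isSymmetric.1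
      (IsSelfAdjoint.of_nonneg (CFC.sqrt_nonneg (CFC.abs A)))
  have hsym : ∀ x y, ⟪S x, y⟫_ℂ = ⟪x, S y⟫_ℂ := fun x y => hsa x y
  have key : ∀ x, RCLike.re ⟪CFC.abs A x, x⟫_ℂ = ‖S x‖ ^ 2 := fun x => by
    rw [← hSS, norm_sq_eq_re_inner (𝕜 := ℂ), ← hsym]
    rfl
  unfold absTraceAlong
  simp only [key]
  simp only [← tsum_norm_sq c (S (b _))]
  rw [ENNReal.tsum_comm]
  simp only [← tsum_norm_sq b (S (c _))]
  refine tsum_congr fun j => tsum_congr fun i => ?_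
  rw [← hsym, norm_inner_symm]

theorem traceNorm_eq {ι : Type*} (b : HilbertBasis ι ℂ H) (A : H →L[ℂ] H) :
    traceNorm A = absTraceAlong b A :=
  absTraceAlong_eq _ _ _

/-- A set of operators is closed with respect to the trace norm: it contains every trace class
operator that is a trace norm limit of its elements. -/
def IsTraceNormClosed (S : Set (H →L[ℂ] H)) : Prop :=
  ∀ A : H →L[ℂ] H, IsTraceClass A →
    (∀ ε : ℝ≥0∞, 0 < ε → ∃ B ∈ S, traceNorm (A - B) < ε) → A ∈ S

end TraceNorm

/-- Quasinilpotence of a bounded operator on a complex normed space that need not be complete: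
the spectrum (in the algebra of bounded operators) has no nonzero point, and
`‖T ^ n‖ ^ (1 / n) → 0`. On a Banach space each of the two conditions implies the other; on an
incomplete space both are required. -/
def IsQuasinilpotent {E : Type*} [NormedAddCommGroup E] [NormedSpace ℂ E] (T : E →L[ℂ] E) :
    Prop :=
  spectrum ℂ T ⊆ {0} ∧
    Filter.Tendsto (fun n : ℕ => ‖T ^ n‖ ^ (1 / (n : ℝ))) Filter.atTop (𝓝 0)

section Lie

variable {H : Type*} [NormedAddCommGroup H] [InnerProductSpace ℂ H]

/-- `ad A : B ↦ A B - B A`, as a bounded operator on the bounded operators on `H`. -/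
def adOp (A : H →L[ℂ] H) : (H →L[ℂ] H) →L[ℂ] (H →L[ℂ] H) :=
  ContinuousLinearMap.mul ℂ (H →L[ℂ] H) A - (ContinuousLinearMap.mul ℂ (H →L[ℂ] H)).flip A

theorem adOp_apply (A B : H →L[ℂ] H) : adOp A B = A * B - B * A := rfl

/-- The restriction of `ad A` to a Lie algebra `L` of operators containing `A`, where `L` carries
the operator norm. -/
def adRestrict (L : LieSubalgebra ℂ (H →L[ℂ] H)) (A : L) : L.toSubmodule →L[ℂ] L.toSubmodule :=
  ((adOp (A : H →L[ℂ] H)).comp L.toSubmodule.subtypeL).codRestrict L.toSubmodule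
    (fun B => L.lie_mem A.2 B.2)

/-- `L` is an Engel Lie algebra: `ad A` restricted to `L` is quasinilpotent for all `A` in `L`. -/
def IsEngel (L : LieSubalgebra ℂ (H →L[ℂ] H)) : Prop :=
  ∀ A : L, IsQuasinilpotent (adRestrict L A)

/-- An operator of finite rank. -/
def IsFiniteRank (F : H →L[ℂ] H) : Prop :=
  FiniteDimensional ℂ (LinearMap.range (F : H →ₗ[ℂ] H))

end Lie

end TraceClassLie

end

/-!
Suppose that `L` contains no nonzero finite rank operator, and let `A ∈ L`. For every
`ε > 0` one finds a circle `|z| = r < ε` that misses the spectrum of `ad A`, and the Riesz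
projection `e = (2πi)⁻¹ ∮ (z - ad A)⁻¹ dz` of the part of the spectrum inside that circle. The point
is that `B - e B` has finite rank for every bounded operator `B`, and lies in `L` if `B` does.
Hence `e` is the identity on `L`, so the powers of `ad A` on `L` are `O(rⁿ)`, and `z - ad A` is
inverted on `L` by the Neumann series for `|z| > r`. As `r` is arbitrarily small, the restriction of
`ad A` to `L` is quasinilpotent.

*Finite rank of `B - e B`* (`exists_adPair_splitting`). The operator `A` is compact with countable
spectrum, so the Riesz projection `q` of `A` for a circle of radius `s < r / 2` commutes with `A`,
`1 - q` has finite rank, and `Aⁿ q = O(sⁿ)` (`exists_finiteRank_splitting`). In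
`B = (1 - q) B + q B (1 - q) + q B q` the first two summands have finite rank, and so have their
images under `1 - e`, which commutes with the multiplications by `q`. On the operators `q B q` the
powers of `ad A` are `O((2 s)ⁿ)`, whereas on the range of `1 - e` the inverse powers are `O(r⁻ⁿ)`;
as `2 s < r`, this forces `(1 - e) (q B q) = 0` (`mul_eq_zero_of_decay`).

*Invariance of `L`* (`snd_mem_of_mem_elemental`). Only the trace norm closes `L`, while
quasinilpotence refers to the operator norm. So everything takes place in the Banach algebra
`PairAlgebra H` of pairs of an operator on the trace class operators (trace norm) and an operator on
the bounded operators (operator norm). There `ad A` is the difference of the commuting left and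
right multiplications by `A`, so by Gelfand theory its spectrum lies in the countable set of
differences of points of the spectrum of `A` (`countable_spectrum_sub`). The complement of a
countable set is connected, so the spectrum does not grow in the closed algebra generated by
`ad A`, and `e` belongs to that algebra (`exists_elemental_splitting`). Its elements agree on the
trace class operators and preserve `L`, since `ad A` does and `L` is trace norm closed.

*The trace norm.* The factorization `A = V √|A| √|A|` and the Cauchy–Schwarz inequality bound the
sums `∑ |⟪C A D eᵢ, eᵢ⟫|` over orthonormal families by `‖C‖ ‖D‖ ‖A‖_tr` (`sum_norm_inner_le`), and
conversely the trace norm is the supremum of `∑ re ⟪U A eᵢ, eᵢ⟫` over contractions `U` and finite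
subfamilies of a Hilbert basis (`traceNorm_le_of_sum_le`). This yields the triangle inequality, the
ideal property and the completeness of the trace class operators, and also the countability of the
spectrum: eigenvectors are orthonormalized by the Gram–Schmidt process, so the moduli of
eigenvalues are summable (`sum_norm_eigenvalue_le`).
-/

noncomputable section

namespace TraceClassLie

open scoped ENNReal InnerProductSpace Topology

/-! ### Polar decomposition and the trace norm -/

section Polar
variable {H : Type*} [NormedAddCommGroup H] [InnerProductSpace ℂ H] [CompleteSpace H]

theorem norm_abs_apply (A : H →L[ℂ] H) (x : H) : ‖CFC.abs A x‖ = ‖A x‖ := by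
  have hsa : IsSelfAdjoint (CFC.abs A) := IsSelfAdjoint.of_nonneg (CFC.abs_nonneg A)
  have h : ‖CFC.abs A x‖ ^ 2 = ‖A x‖ ^ 2 := by
    rw [norm_sq_eq_re_inner (𝕜 := ℂ), norm_sq_eq_re_inner (𝕜 := ℂ),
      ← ContinuousLinearMap.adjoint_inner_left, ← ContinuousLinearMap.adjoint_inner_left,
      ← ContinuousLinearMap.star_eq_adjoint, ← ContinuousLinearMap.star_eq_adjoint, hsa.star_eq,
      ← mul_apply_eq_comp, ← mul_apply_eq_comp, CFC.abs_mul_abs]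
  exact (sq_eq_sq₀ (norm_nonneg _) (norm_nonneg _)).1 h

/-- The polar decomposition of `A`, with a contraction in place of a partial isometry. -/
theorem exists_polar (A : H →L[ℂ] H) :
    ∃ V : H →L[ℂ] H, ‖V‖ ≤ 1 ∧ V * CFC.abs A = A ∧ star V * A = CFC.abs A := by
  let K : Submodule ℂ H :=
    (LinearMap.range ((CFC.abs A : H →L[ℂ] H) : H →ₗ[ℂ] H)).topologicalClosure
  have hK : IsClosed (K : Set H) := Submodule.isClosed_topologicalClosure _
  have : CompleteSpace K := hK.completeSpace_coe
  have hmem : ∀ x, CFC.abs A x ∈ K := fun x =>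
    Submodule.le_topologicalClosure _ ⟨x, rfl⟩
  let e : H →ₗ[ℂ] K := ((CFC.abs A : H →L[ℂ] H) : H →ₗ[ℂ] H).codRestrict K hmem
  have hdense : DenseRange e := by
    intro y
    rw [Metric.mem_closure_iff]
    intro ε hε
    have hy : (y : H) ∈
        closure (LinearMap.range ((CFC.abs A : H →L[ℂ] H) : H →ₗ[ℂ] H) : Set H) := y.2
    obtain ⟨z, ⟨x, rfl⟩, hz⟩ := Metric.mem_closure_iff.1 hy ε hε
    exact ⟨e x, ⟨x, rfl⟩, hz⟩
  have hnorm : ∀ x, ‖(A : H →ₗ[ℂ] H) x‖ ≤ 1 * ‖e x‖ := fun x => by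
    rw [one_mul]
    exact (norm_abs_apply A x).ge
  let W : K →L[ℂ] H := (A : H →ₗ[ℂ] H).extendOfNorm e
  have hW : ∀ y, ‖W y‖ ≤ 1 * ‖y‖ := LinearMap.norm_extendOfNorm_apply_le hdense 1 hnorm
  let V : H →L[ℂ] H := W.comp K.orthogonalProjectionOnto
  have hV1 : ‖V‖ ≤ 1 := by
    refine ContinuousLinearMap.opNorm_le_bound _ zero_le_one fun x => (hW _).trans ?_
    rw [one_mul, one_mul]
    exact K.norm_orthogonalProjectionOnto_apply_le x
  have hVA : ∀ x, V (CFC.abs A x) = A x := fun x => by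
    have h1 : K.orthogonalProjectionOnto (CFC.abs A x) = e x :=
      K.orthogonalProjectionOnto_mem_subspace_eq_self (e x)
    change W (K.orthogonalProjectionOnto (CFC.abs A x)) = A x
    rw [h1]
    exact LinearMap.extendOfNorm_eq hdense ⟨1, hnorm⟩ x
  refine ⟨V, hV1, ContinuousLinearMap.ext hVA, ContinuousLinearMap.ext fun x => ?_⟩
  -- A contraction that preserves the norm of `u` satisfies `V* V u = u`.
  set u := CFC.abs A x with hu
  have hVu : ‖V u‖ = ‖u‖ := by rw [hVA, hu, norm_abs_apply]
  have hle : ‖star V (V u)‖ ≤ ‖V u‖ := by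
    refine (ContinuousLinearMap.le_opNorm _ _).trans ?_
    rw [norm_star]
    exact mul_le_of_le_one_left (norm_nonneg _) hV1
  have hin : RCLike.re ⟪star V (V u), u⟫_ℂ = ‖V u‖ ^ 2 := by
    rw [ContinuousLinearMap.star_eq_adjoint, ContinuousLinearMap.adjoint_inner_left,
      norm_sq_eq_re_inner (𝕜 := ℂ)]
  have hsq : ‖star V (V u) - u‖ ^ 2 ≤ 0 := by
    rw [norm_sub_sq (𝕜 := ℂ), hin, hVu]
    rw [hVu] at hle
    nlinarith [norm_nonneg (star V (V u)), norm_nonneg u]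
  have h0 : star V (V u) - u = 0 := by
    rw [← norm_eq_zero]
    exact pow_eq_zero_iff two_ne_zero |>.1 (le_antisymm hsq (sq_nonneg _))
  change star V (A x) = u
  rw [← hVA]
  exact sub_eq_zero.1 h0

theorem re_inner_abs_self (A : H →L[ℂ] H) (x : H) :
    RCLike.re ⟪CFC.abs A x, x⟫_ℂ = ‖CFC.sqrt (CFC.abs A) x‖ ^ 2 := by
  have hSS : CFC.sqrt (CFC.abs A) * CFC.sqrt (CFC.abs A) = CFC.abs A :=
    CFC.sqrt_mul_sqrt_self _ (CFC.abs_nonneg A)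
  have hsa : IsSelfAdjoint (CFC.sqrt (CFC.abs A)) :=
    IsSelfAdjoint.of_nonneg (CFC.sqrt_nonneg (CFC.abs A))
  conv_lhs => rw [← hSS]
  rw [norm_sq_eq_re_inner (𝕜 := ℂ), ← ContinuousLinearMap.adjoint_inner_left,
    ← ContinuousLinearMap.star_eq_adjoint, hsa.star_eq]
  rfl

theorem traceNorm_eq_tsum_norm_sqrt_sq {ι : Type*} (b : HilbertBasis ι ℂ H) (A : H →L[ℂ] H) :
    traceNorm A = ∑' i, ENNReal.ofReal (‖CFC.sqrt (CFC.abs A) (b i)‖ ^ 2) := by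
  rw [traceNorm_eq b]
  exact tsum_congr fun i => by rw [re_inner_abs_self]

/-- The Hilbert–Schmidt norm of `T` bounds the one of `T*`, which may be computed along any
orthonormal family. -/
theorem sum_norm_adjoint_sq_le {ι κ : Type*} (b : HilbertBasis ι ℂ H) (T : H →L[ℂ] H)
    {e : κ → H} (he : Orthonormal ℂ e) (J : Finset κ) :
    ∑ i ∈ J, ENNReal.ofReal (‖star T (e i)‖ ^ 2) ≤ ∑' k, ENNReal.ofReal (‖T (b k)‖ ^ 2) := by
  simp only [← tsum_norm_sq b (star T (e _))]
  rw [← Summable.tsum_finsetSum fun _ _ => ENNReal.summable]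
  refine ENNReal.tsum_le_tsum fun k => ?_
  rw [← ENNReal.ofReal_sum_of_nonneg fun _ _ => sq_nonneg _]
  refine ENNReal.ofReal_le_ofReal (le_trans (le_of_eq ?_)
    (he.sum_inner_products_le (s := J) (T (b k))))
  refine Finset.sum_congr rfl fun i _ => ?_
  rw [ContinuousLinearMap.star_eq_adjoint, ContinuousLinearMap.adjoint_inner_right,
    norm_inner_symm]

theorem sum_norm_sqrt_mul_sq_le {κ : Type*} {A : H →L[ℂ] H} (hA : IsTraceClass A)
    (D : H →L[ℂ] H) {e : κ → H} (he : Orthonormal ℂ e) (J : Finset κ) :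
    ∑ i ∈ J, ‖CFC.sqrt (CFC.abs A) (D (e i))‖ ^ 2 ≤ ‖D‖ ^ 2 * (traceNorm A).toReal := by
  have hsa : IsSelfAdjoint (CFC.sqrt (CFC.abs A)) :=
    IsSelfAdjoint.of_nonneg (CFC.sqrt_nonneg (CFC.abs A))
  have h := sum_norm_adjoint_sq_le (someBasis H) (star D * CFC.sqrt (CFC.abs A)) he J
  rw [star_mul, star_star, hsa.star_eq, ← ENNReal.ofReal_sum_of_nonneg fun _ _ => sq_nonneg _] at h
  have h2 : ∑' k, ENNReal.ofReal (‖(star D * CFC.sqrt (CFC.abs A)) (someBasis H k)‖ ^ 2) ≤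
      ENNReal.ofReal (‖D‖ ^ 2) * traceNorm A := by
    rw [traceNorm_eq_tsum_norm_sqrt_sq (someBasis H), ← ENNReal.tsum_mul_left]
    refine ENNReal.tsum_le_tsum fun k => ?_
    rw [← ENNReal.ofReal_mul (sq_nonneg _), ← mul_pow]
    refine ENNReal.ofReal_le_ofReal (pow_le_pow_left₀ (norm_nonneg _) ?_ 2)
    refine ((star D).le_opNorm _).trans_eq ?_
    rw [norm_star]
    rfl
  have h3 := h.trans h2
  rw [← ENNReal.ofReal_toReal hA.ne, ← ENNReal.ofReal_mul (sq_nonneg _)] at h3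
  exact (ENNReal.ofReal_le_ofReal_iff (by positivity)).1 h3

/-- The basic inequality of the trace norm, by the Cauchy–Schwarz inequality applied to the
factorization `A = V √|A| √|A|`. -/
theorem sum_norm_inner_le {κ : Type*} {A : H →L[ℂ] H} (hA : IsTraceClass A)
    (C D : H →L[ℂ] H) {e : κ → H} (he : Orthonormal ℂ e) (J : Finset κ) :
    ∑ i ∈ J, ‖⟪(C * A * D) (e i), e i⟫_ℂ‖ ≤ ‖C‖ * ‖D‖ * (traceNorm A).toReal := by
  obtain ⟨V, hV, hVA, -⟩ := exists_polar A
  set S := CFC.sqrt (CFC.abs A) with hS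
  have hsa : IsSelfAdjoint S := IsSelfAdjoint.of_nonneg (CFC.sqrt_nonneg (CFC.abs A))
  have hSS : S * S = CFC.abs A := CFC.sqrt_mul_sqrt_self _ (CFC.abs_nonneg A)
  have hterm : ∀ i, ‖⟪(C * A * D) (e i), e i⟫_ℂ‖ ≤ ‖S (D (e i))‖ * ‖S (star (C * V) (e i))‖ := by
    intro i
    have : ⟪(C * A * D) (e i), e i⟫_ℂ = ⟪S (D (e i)), S (star (C * V) (e i))⟫_ℂ := by
      conv_rhs => rw [← hsa.star_eq, ContinuousLinearMap.star_eq_adjoint (A := S),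
        ContinuousLinearMap.adjoint_inner_right,
        ContinuousLinearMap.star_eq_adjoint, ContinuousLinearMap.adjoint_inner_right,
        ← ContinuousLinearMap.star_eq_adjoint, hsa.star_eq]
      have : C * A * D = (C * V) * (S * (S * D)) := by
        rw [← mul_assoc S, hSS, mul_assoc C V, ← mul_assoc V, hVA, mul_assoc]
      rw [this]
      rfl
    rw [this]
    exact norm_inner_le_norm _ _
  have h1 := sum_norm_sqrt_mul_sq_le hA D he J
  have h2 := sum_norm_sqrt_mul_sq_le hA (star (C * V)) he J
  have h2' : ‖star (C * V)‖ ≤ ‖C‖ := by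
    rw [norm_star]
    exact (norm_mul_le _ _).trans (mul_le_of_le_one_right (norm_nonneg _) hV)
  set M := (traceNorm A).toReal with hM
  have hM0 : 0 ≤ M := ENNReal.toReal_nonneg
  calc _ ≤ ∑ i ∈ J, ‖S (D (e i))‖ * ‖S (star (C * V) (e i))‖ := Finset.sum_le_sum fun i _ => hterm i
    _ ≤ √(∑ i ∈ J, ‖S (D (e i))‖ ^ 2) * √(∑ i ∈ J, ‖S (star (C * V) (e i))‖ ^ 2) :=
      Real.sum_mul_le_sqrt_mul_sqrt _ _ _
    _ ≤ √(‖D‖ ^ 2 * M) * √(‖C‖ ^ 2 * M) := by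
      refine mul_le_mul (Real.sqrt_le_sqrt h1) (Real.sqrt_le_sqrt (h2.trans ?_))
        (Real.sqrt_nonneg _) (Real.sqrt_nonneg _)
      gcongr
    _ = ‖C‖ * ‖D‖ * M := by
      rw [Real.sqrt_mul (sq_nonneg _), Real.sqrt_mul (sq_nonneg _), Real.sqrt_sq (norm_nonneg _),
        Real.sqrt_sq (norm_nonneg _)]
      linear_combination ‖C‖ * ‖D‖ * Real.mul_self_sqrt hM0

/-- The trace norm is attained by the contraction `U = V*` of the polar decomposition, as
`V* A = |A|`. -/
theorem traceNorm_le_of_sum_le {A : H →L[ℂ] H} {M : ℝ}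
    (h : ∀ (U : H →L[ℂ] H), ‖U‖ ≤ 1 → ∀ J : Finset (exists_hilbertBasis ℂ H).choose,
      ∑ i ∈ J, RCLike.re ⟪(U * A) (someBasis H i), someBasis H i⟫_ℂ ≤ M) :
    traceNorm A ≤ ENNReal.ofReal M := by
  obtain ⟨V, hV, -, hVA⟩ := exists_polar A
  unfold traceNorm absTraceAlong
  rw [ENNReal.tsum_eq_iSup_sum]
  refine iSup_le fun J => ?_
  rw [← ENNReal.ofReal_sum_of_nonneg]
  · refine ENNReal.ofReal_le_ofReal ?_
    rw [← hVA]
    exact h _ (by rwa [norm_star]) J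
  · intro i _
    rw [re_inner_abs_self]
    exact sq_nonneg _

theorem sum_re_inner_le {A : H →L[ℂ] H} (hA : IsTraceClass A) {κ : Type*} {e : κ → H}
    (he : Orthonormal ℂ e) (J : Finset κ) (C D : H →L[ℂ] H) :
    ∑ i ∈ J, RCLike.re ⟪(C * A * D) (e i), e i⟫_ℂ ≤ ‖C‖ * ‖D‖ * (traceNorm A).toReal :=
  (Finset.sum_le_sum fun _ _ => RCLike.re_le_norm _).trans (sum_norm_inner_le hA C D he J)

theorem traceNorm_mul_mul_le {A : H →L[ℂ] H} (hA : IsTraceClass A) (C D : H →L[ℂ] H) :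
    traceNorm (C * A * D) ≤ ENNReal.ofReal (‖C‖ * ‖D‖ * (traceNorm A).toReal) := by
  refine traceNorm_le_of_sum_le fun U hU J => ?_
  have := sum_re_inner_le hA (someBasis H).orthonormal J (U * C) D
  rw [mul_assoc U, mul_assoc U] at this
  refine this.trans ?_
  gcongr
  exact (norm_mul_le _ _).trans (mul_le_of_le_one_left (norm_nonneg _) hU)

theorem traceNorm_add_le {A B : H →L[ℂ] H} (hA : IsTraceClass A) (hB : IsTraceClass B) :
    traceNorm (A + B) ≤ ENNReal.ofReal ((traceNorm A).toReal + (traceNorm B).toReal) := by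
  refine traceNorm_le_of_sum_le fun U hU J => ?_
  have h1 := sum_re_inner_le hA (someBasis H).orthonormal J U 1
  have h2 := sum_re_inner_le hB (someBasis H).orthonormal J U 1
  have key : ∀ A : H →L[ℂ] H, ‖U‖ * ‖(1 : H →L[ℂ] H)‖ * (traceNorm A).toReal ≤
      (traceNorm A).toReal := fun A =>
    mul_le_of_le_one_left ENNReal.toReal_nonneg
      (mul_le_one₀ hU (norm_nonneg _) ContinuousLinearMap.norm_id_le)
  rw [mul_one] at h1 h2
  simp only [mul_add, add_apply, inner_add_left, map_add,
    Finset.sum_add_distrib]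
  exact add_le_add (h1.trans (key A)) (h2.trans (key B))

theorem opNorm_le_traceNorm {A : H →L[ℂ] H} (hA : IsTraceClass A) :
    ‖A‖ ≤ (traceNorm A).toReal := by
  have hsa : IsSelfAdjoint (CFC.sqrt (CFC.abs A)) :=
    IsSelfAdjoint.of_nonneg (CFC.sqrt_nonneg (CFC.abs A))
  have hSS : CFC.sqrt (CFC.abs A) * CFC.sqrt (CFC.abs A) = CFC.abs A :=
    CFC.sqrt_mul_sqrt_self _ (CFC.abs_nonneg A)
  set S := CFC.sqrt (CFC.abs A)
  have h1 : ‖A‖ = ‖S‖ ^ 2 := by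
    rw [← CFC.norm_abs, ← hSS, sq, ← CStarRing.norm_star_mul_self, hsa.star_eq]
  have hS : ‖S‖ ≤ √(traceNorm A).toReal := by
    refine ContinuousLinearMap.opNorm_le_bound _ (Real.sqrt_nonneg _) fun x => ?_
    by_cases hx : x = 0
    · simp [hx]
    -- A unit vector is an orthonormal family.
    have hx' : ‖x‖ ≠ 0 := norm_ne_zero_iff.2 hx
    have he : Orthonormal ℂ (fun _ : Unit => ((‖x‖ : ℂ)⁻¹ • x)) := by
      refine ⟨fun _ => ?_, fun i j hij => (hij rfl).elim⟩
      rw [norm_smul, norm_inv, Complex.norm_real, norm_norm, inv_mul_cancel₀ hx']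
    have h := sum_norm_sqrt_mul_sq_le hA 1 he Finset.univ
    have h1 : ‖(1 : H →L[ℂ] H)‖ ^ 2 ≤ 1 :=
      pow_le_one₀ (norm_nonneg _) ContinuousLinearMap.norm_id_le
    have h2 := h.trans (mul_le_of_le_one_left ENNReal.toReal_nonneg h1)
    simp only [Finset.univ_unique, Finset.sum_singleton, one_apply_eq_self,
      map_smul, norm_smul, norm_inv, Complex.norm_real, norm_norm] at h2
    have h3 := Real.le_sqrt_of_sq_le h2
    rwa [inv_mul_le_iff₀ (by positivity), mul_comm] at h3
  rw [h1]
  calc ‖S‖ ^ 2 ≤ √(traceNorm A).toReal ^ 2 := pow_le_pow_left₀ (norm_nonneg _) hS 2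
    _ = _ := Real.sq_sqrt ENNReal.toReal_nonneg

/-- Lower semicontinuity of the trace norm with respect to the operator norm. -/
theorem traceNorm_le_of_tendsto {A : ℕ → H →L[ℂ] H} {B : H →L[ℂ] H} {M : ℝ}
    (hA : ∀ n, IsTraceClass (A n)) (hlim : Filter.Tendsto A Filter.atTop (𝓝 B))
    (hM : ∀ᶠ n in Filter.atTop, (traceNorm (A n)).toReal ≤ M) :
    traceNorm B ≤ ENNReal.ofReal M := by
  refine traceNorm_le_of_sum_le fun U hU J => ?_
  have hc : Continuous fun X : H →L[ℂ] H =>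
      ∑ i ∈ J, RCLike.re ⟪(U * X) (someBasis H i), someBasis H i⟫_ℂ := by
    refine continuous_finsetSum _ fun i _ => RCLike.continuous_re.comp ?_
    refine Continuous.inner ?_ continuous_const
    exact U.continuous.comp (ContinuousLinearMap.apply ℂ H (someBasis H i)).continuous
  refine le_of_tendsto ((hc.tendsto B).comp hlim) (hM.mono fun n hn => ?_)
  have h := sum_re_inner_le (hA n) (someBasis H).orthonormal J U 1
  rw [mul_one] at h
  refine h.trans (le_trans ?_ hn)
  exact mul_le_of_le_one_left ENNReal.toReal_nonneg
      (mul_le_one₀ hU (norm_nonneg _) ContinuousLinearMap.norm_id_le)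

theorem traceNorm_zero : traceNorm (0 : H →L[ℂ] H) = 0 := by
  simp [traceNorm, absTraceAlong]

end Polar

/-! ### The Banach space of trace class operators -/

section TraceClassSpace
variable {H : Type*} [NormedAddCommGroup H] [InnerProductSpace ℂ H] [CompleteSpace H]

theorem IsTraceClass.mul_mul {A : H →L[ℂ] H} (hA : IsTraceClass A) (C D : H →L[ℂ] H) :
    IsTraceClass (C * A * D) :=
  (traceNorm_mul_mul_le hA C D).trans_lt ENNReal.ofReal_lt_top

theorem IsTraceClass.add {A B : H →L[ℂ] H} (hA : IsTraceClass A) (hB : IsTraceClass B) :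
    IsTraceClass (A + B) :=
  (traceNorm_add_le hA hB).trans_lt ENNReal.ofReal_lt_top

theorem traceNorm_mul_mul_toReal_le {A : H →L[ℂ] H} (hA : IsTraceClass A) (C D : H →L[ℂ] H) :
    (traceNorm (C * A * D)).toReal ≤ ‖C‖ * ‖D‖ * (traceNorm A).toReal :=
  ENNReal.toReal_le_of_le_ofReal (by positivity) (traceNorm_mul_mul_le hA C D)

theorem traceNorm_smul_toReal_le {A : H →L[ℂ] H} (hA : IsTraceClass A) (c : ℂ) :
    (traceNorm (c • A)).toReal ≤ ‖c‖ * (traceNorm A).toReal := by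
  have h := traceNorm_mul_mul_toReal_le hA (c • 1) 1
  rw [smul_one_mul, mul_one] at h
  refine h.trans (mul_le_mul_of_nonneg_right ?_ ENNReal.toReal_nonneg)
  rw [norm_smul, mul_assoc]
  exact mul_le_of_le_one_right (norm_nonneg _)
    (mul_le_one₀ ContinuousLinearMap.norm_id_le (norm_nonneg _) ContinuousLinearMap.norm_id_le)

theorem IsTraceClass.smul {A : H →L[ℂ] H} (hA : IsTraceClass A) (c : ℂ) :
    IsTraceClass (c • A) := by
  have h := hA.mul_mul (c • 1) 1
  rwa [smul_one_mul, mul_one] at h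

variable (H) in
/-- The trace class operators, as a subspace of the bounded operators. -/
def traceClassSubmodule : Submodule ℂ (H →L[ℂ] H) where
  carrier := {A | IsTraceClass A}
  zero_mem' := by
    change traceNorm 0 < ∞
    rw [traceNorm_zero]
    exact ENNReal.zero_lt_top
  add_mem' := IsTraceClass.add
  smul_mem' c _ hA := hA.smul c

variable (H) in
/-- The space of trace class operators. This is a type synonym of the subspace
`traceClassSubmodule H`, so that it can carry the trace norm instead of the operator norm. -/
def TraceClass : Type _ := traceClassSubmodule H

instance : AddCommGroup (TraceClass H) := inferInstanceAs (AddCommGroup (traceClassSubmodule H))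

instance : Module ℂ (TraceClass H) := inferInstanceAs (Module ℂ (traceClassSubmodule H))

/-- The inclusion of the trace class operators into the bounded operators, as a linear map. -/
def toOp₀ : TraceClass H →ₗ[ℂ] (H →L[ℂ] H) := (traceClassSubmodule H).subtype

theorem toOp₀_injective : Function.Injective (toOp₀ (H := H)) := Subtype.val_injective

theorem isTraceClass_toOp₀ (X : TraceClass H) : IsTraceClass (toOp₀ X) := X.2

instance : Norm (TraceClass H) := ⟨fun X => (traceNorm (toOp₀ X)).toReal⟩

theorem norm_def (X : TraceClass H) : ‖X‖ = (traceNorm (toOp₀ X)).toReal := rfl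

variable (H) in
theorem traceClass_normedSpaceCore : NormedSpace.Core ℂ (TraceClass H) where
  norm_nonneg _ := ENNReal.toReal_nonneg
  norm_smul c X := by
    have hle : ∀ (c : ℂ) (X : TraceClass H), ‖c • X‖ ≤ ‖c‖ * ‖X‖ := fun c X => by
      rw [norm_def, map_smul]
      exact traceNorm_smul_toReal_le (isTraceClass_toOp₀ X) c
    refine le_antisymm (hle c X) ?_
    by_cases hc : c = 0
    · rw [hc, norm_zero, zero_mul]
      exact ENNReal.toReal_nonneg
    have h := hle c⁻¹ (c • X)
    rwa [inv_smul_smul₀ hc, norm_inv, ← div_eq_inv_mul, le_div_iff₀ (norm_pos_iff.2 hc),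
      mul_comm] at h
  norm_triangle X Y := by
    rw [norm_def, map_add]
    exact ENNReal.toReal_le_of_le_ofReal (add_nonneg ENNReal.toReal_nonneg ENNReal.toReal_nonneg)
      (traceNorm_add_le (isTraceClass_toOp₀ X) (isTraceClass_toOp₀ Y))
  norm_eq_zero_iff X := by
    constructor
    · intro h
      have h1 := opNorm_le_traceNorm (isTraceClass_toOp₀ X)
      rw [← norm_def, h] at h1
      exact toOp₀_injective ((norm_le_zero_iff.1 h1).trans (map_zero _).symm)
    · rintro rfl
      rw [norm_def, map_zero, traceNorm_zero, ENNReal.toReal_zero]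

instance : NormedAddCommGroup (TraceClass H) :=
  NormedAddCommGroup.ofCore (traceClass_normedSpaceCore H)

instance : NormedSpace ℂ (TraceClass H) := NormedSpace.ofCore (traceClass_normedSpaceCore H)

variable (H) in
/-- The inclusion of the trace class operators, with the trace norm, into the bounded operators. -/
def toOp : TraceClass H →L[ℂ] (H →L[ℂ] H) :=
  toOp₀.mkContinuous 1 fun X => by
    rw [one_mul]
    exact opNorm_le_traceNorm (isTraceClass_toOp₀ X)

theorem toOp_injective : Function.Injective (toOp H) := toOp₀_injective

theorem isTraceClass_toOp (X : TraceClass H) : IsTraceClass (toOp H X) := X.2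

theorem norm_eq_traceNorm (X : TraceClass H) : ‖X‖ = (traceNorm (toOp H X)).toReal := rfl

/-- A trace class operator as an element of the Banach space of trace class operators. -/
def ofOp (A : H →L[ℂ] H) (hA : IsTraceClass A) : TraceClass H := ⟨A, hA⟩

theorem toOp_ofOp (A : H →L[ℂ] H) (hA : IsTraceClass A) : toOp H (ofOp A hA) = A := rfl

instance : CompleteSpace (TraceClass H) := by
  refine Metric.complete_of_cauchySeq_tendsto fun X hX => ?_
  obtain ⟨B, hB⟩ := cauchySeq_tendsto_of_complete ((toOp H).lipschitz.cauchySeq_comp hX)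
  -- The tail bound of the Cauchy sequence passes to the operator norm limit.
  have key : ∀ ε : ℝ, 0 < ε → ∃ N, ∀ n ≥ N,
      traceNorm (toOp H (X n) - B) ≤ ENNReal.ofReal ε := by
    intro ε hε
    obtain ⟨N, hN⟩ := Metric.cauchySeq_iff.1 hX ε hε
    refine ⟨N, fun n hn => ?_⟩
    refine traceNorm_le_of_tendsto (A := fun m => toOp H (X n - X m))
      (fun m => isTraceClass_toOp _) ?_ ?_
    · simp only [map_sub]
      exact tendsto_const_nhds.sub hB
    · filter_upwards [Filter.eventually_ge_atTop N] with m hm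
      rw [← norm_eq_traceNorm, ← dist_eq_norm]
      exact (hN n hn m hm).le
  obtain ⟨N, hN⟩ := key 1 one_pos
  have hNB : IsTraceClass (toOp H (X N) - B) := (hN N le_rfl).trans_lt ENNReal.ofReal_lt_top
  have hBt : IsTraceClass B := by
    have := (isTraceClass_toOp (X N)).add (hNB.smul (-1))
    rwa [neg_one_smul, neg_sub, add_sub_cancel] at this
  refine ⟨ofOp B hBt, Metric.tendsto_atTop.2 fun ε hε => ?_⟩
  obtain ⟨N, hN⟩ := key (ε / 2) (half_pos hε)
  refine ⟨N, fun n hn => ?_⟩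
  rw [dist_eq_norm, norm_eq_traceNorm, map_sub, toOp_ofOp]
  exact (ENNReal.toReal_le_of_le_ofReal (half_pos hε).le (hN n hn)).trans_lt (half_lt_self hε)

end TraceClassSpace

/-! ### Compactness and spectrum of trace class operators -/

section Compact

/-- An operator with square summable values on a Hilbert basis is compact. -/
theorem isCompactOperator_of_tsum_lt_top {ι H : Type*} [NormedAddCommGroup H]
    [InnerProductSpace ℂ H] [CompleteSpace H] (b : HilbertBasis ι ℂ H) {T : H →L[ℂ] H}
    (hT : ∑' i, ENNReal.ofReal (‖T (b i)‖ ^ 2) < ∞) : IsCompactOperator T := by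
  classical
  -- `T` is the operator norm limit of its restrictions to the coordinate subspaces.
  let F : Finset ι → H →L[ℂ] H := fun J =>
    ∑ i ∈ J, (ContinuousLinearMap.toSpanSingleton ℂ (T (b i))).comp (innerSL ℂ (b i))
  have hF : ∀ J, IsCompactOperator (F J) := fun J => by
    refine (compactOperator (RingHom.id ℂ) H H).sum_mem fun i _ => ?_
    have h : IsCompactOperator (ContinuousLinearMap.toSpanSingleton ℂ (T (b i))) :=
      isCompactOperator_of_locallyCompactSpace_rng
        (ContinuousLinearMap.toSpanSingleton ℂ (T (b i)))
    exact h.comp_clm (innerSL ℂ (b i))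
  have hsum : Summable fun i => ‖T (b i)‖ ^ 2 := by
    have := ENNReal.summable_toReal hT.ne
    simpa only [ENNReal.toReal_ofReal (sq_nonneg _)] using this
  refine isCompactOperator_of_tendsto (l := Filter.atTop) (F := F) ?_
    (Filter.Eventually.of_forall hF)
  rw [tendsto_iff_norm_sub_tendsto_zero]
  have htail := tendsto_tsum_compl_atTop_zero fun i => ‖T (b i)‖ ^ 2
  have hbound : ∀ J : Finset ι, ‖F J - T‖ ≤ √(∑' i : {i // i ∉ J}, ‖T (b i)‖ ^ 2) := by
    intro J
    refine ContinuousLinearMap.opNorm_le_bound _ (Real.sqrt_nonneg _) fun x => ?_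
    have hx : HasSum (fun i => (⟪b i, x⟫_ℂ) • T (b i)) (T x) := by
      have := (b.hasSum_repr x).mapL T
      simpa only [map_smul, b.repr_apply_apply] using this
    have hFx : F J x = ∑ i ∈ J, (⟪b i, x⟫_ℂ) • T (b i) := by
      simp [F]
    have hx' : Filter.Tendsto (fun J => ∑ i ∈ J, (⟪b i, x⟫_ℂ) • T (b i)) Filter.atTop
        (𝓝 (T x)) := by
      simpa only [HasSum, SummationFilter.unconditional_filter] using hx
    refine le_of_tendsto (tendsto_const_nhds.sub hx').norm ?_
    filter_upwards [Filter.eventually_ge_atTop J] with K hK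
    change ‖F J x - ∑ i ∈ K, _‖ ≤ _
    rw [hFx, ← Finset.sum_sdiff hK, ← norm_neg, neg_sub, add_sub_cancel_right]
    calc ‖∑ i ∈ K \ J, ⟪b i, x⟫_ℂ • T (b i)‖ ≤ ∑ i ∈ K \ J, ‖⟪b i, x⟫_ℂ‖ * ‖T (b i)‖ := by
          refine (norm_sum_le _ _).trans_eq ?_
          simp only [norm_smul]
      _ ≤ √(∑ i ∈ K \ J, ‖⟪b i, x⟫_ℂ‖ ^ 2) * √(∑ i ∈ K \ J, ‖T (b i)‖ ^ 2) :=
        Real.sum_mul_le_sqrt_mul_sqrt _ _ _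
      _ ≤ √(‖x‖ ^ 2) * √(∑' i : {i // i ∉ J}, ‖T (b i)‖ ^ 2) := by
        refine mul_le_mul (Real.sqrt_le_sqrt (b.orthonormal.sum_inner_products_le x))
          (Real.sqrt_le_sqrt ?_) (Real.sqrt_nonneg _) (Real.sqrt_nonneg _)
        have h1 : ∑ i ∈ K \ J, ‖T (b i)‖ ^ 2 =
            ∑ i ∈ (K \ J).subtype (· ∉ J), ‖T (b i)‖ ^ 2 := by
          rw [Finset.sum_subtype_of_mem (fun i => ‖T (b i)‖ ^ 2)]
          exact fun i hi => (Finset.mem_sdiff.1 hi).2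
        rw [h1]
        exact (hsum.subtype _).sum_le_tsum _ fun _ _ => sq_nonneg _
      _ = _ := by rw [Real.sqrt_sq (norm_nonneg _), mul_comm]
  refine squeeze_zero (fun _ => norm_nonneg _) hbound ?_
  have := (Real.continuous_sqrt.tendsto 0).comp htail
  rwa [Real.sqrt_zero] at this

variable {H : Type*} [NormedAddCommGroup H] [InnerProductSpace ℂ H] [CompleteSpace H]

/-- `A = V √|A| √|A|`, where `√|A|` is a Hilbert–Schmidt operator. -/
theorem IsTraceClass.isCompactOperator {A : H →L[ℂ] H} (hA : IsTraceClass A) :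
    IsCompactOperator A := by
  obtain ⟨V, -, hVA, -⟩ := exists_polar A
  have hSS : CFC.sqrt (CFC.abs A) * CFC.sqrt (CFC.abs A) = CFC.abs A :=
    CFC.sqrt_mul_sqrt_self _ (CFC.abs_nonneg A)
  have hS : IsCompactOperator (CFC.sqrt (CFC.abs A) : H →L[ℂ] H) := by
    refine isCompactOperator_of_tsum_lt_top (someBasis H) ?_
    rw [← traceNorm_eq_tsum_norm_sqrt_sq]
    exact hA
  have := hS.clm_comp (V * CFC.sqrt (CFC.abs A))
  rw [← ContinuousLinearMap.coe_comp, ← ContinuousLinearMap.mul_def, mul_assoc, hSS, hVA] at this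
  exact this

/-- Eigenvalues of `A` become diagonal entries of `A` in the orthonormal family obtained from the
eigenvectors by the Gram–Schmidt process, so their sum is controlled by the trace norm. -/
theorem sum_norm_eigenvalue_le {A : H →L[ℂ] H} (hA : IsTraceClass A) {n : ℕ} {v : Fin n → H}
    {μ : Fin n → ℂ} (hμ : ∀ i, A (v i) = μ i • v i) (hv : LinearIndependent ℂ v) :
    ∑ i, ‖μ i‖ ≤ (traceNorm A).toReal := by
  set e := InnerProductSpace.gramSchmidtNormed ℂ v with he
  have hon : Orthonormal ℂ e := InnerProductSpace.gramSchmidtNormed_orthonormal hv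
  have hinv : ∀ i, ∀ x ∈ Submodule.span ℂ (v '' Set.Iio i),
      A x ∈ Submodule.span ℂ (v '' Set.Iio i) := by
    intro i x hx
    induction hx using Submodule.span_induction with
    | mem x hx =>
      obtain ⟨j, hj, rfl⟩ := hx
      rw [hμ]
      exact Submodule.smul_mem _ _ (Submodule.subset_span ⟨j, hj, rfl⟩)
    | zero => rw [map_zero]; exact zero_mem _
    | add x y _ _ hx hy => rw [map_add]; exact add_mem hx hy
    | smul c x _ hx => rw [map_smul]; exact Submodule.smul_mem _ _ hx
  -- `e i` is orthogonal to the span of the `v j` with `j < i`, which `A` leaves invariant.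
  have horth : ∀ i, ∀ x ∈ Submodule.span ℂ (v '' Set.Iio i), ⟪x, e i⟫_ℂ = 0 := by
    intro i x hx
    rw [← InnerProductSpace.span_gramSchmidt_Iio, ← InnerProductSpace.span_gramSchmidtNormed] at hx
    induction hx using Submodule.span_induction with
    | mem x hx =>
      obtain ⟨j, hj, rfl⟩ := hx
      exact hon.2 (ne_of_lt hj)
    | zero => exact inner_zero_left _
    | add x y _ _ hx hy => rw [inner_add_left, hx, hy, add_zero]
    | smul c x _ hx => rw [inner_smul_left, hx, mul_zero]
  have hdiag : ∀ i, ‖⟪A (e i), e i⟫_ℂ‖ = ‖μ i‖ := by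
    intro i
    obtain ⟨c, w, hw, hcw⟩ : ∃ c : ℂ, ∃ w ∈ Submodule.span ℂ (v '' Set.Iio i),
        e i = c • v i + w := by
      have h1 := InnerProductSpace.gramSchmidt_def ℂ v i
      refine ⟨((‖InnerProductSpace.gramSchmidt ℂ v i‖ : ℂ))⁻¹,
        -(((‖InnerProductSpace.gramSchmidt ℂ v i‖ : ℂ))⁻¹ • ∑ j ∈ Finset.Iio i,
          (Submodule.span ℂ {InnerProductSpace.gramSchmidt ℂ v j}).starProjection (v i)),
        ?_, ?_⟩
      · refine Submodule.neg_mem _ (Submodule.smul_mem _ _ (Submodule.sum_mem _ fun j hj => ?_))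
        rw [← InnerProductSpace.span_gramSchmidt_Iio]
        refine Submodule.span_mono ?_ (Submodule.starProjection_apply_mem _ (v i))
        rintro _ rfl
        exact ⟨j, Finset.mem_Iio.1 hj, rfl⟩
      · rw [he]
        unfold InnerProductSpace.gramSchmidtNormed
        rw [← sub_eq_add_neg, ← smul_sub, ← h1]
        rfl
    have h2 : A (e i) = μ i • e i + (A w - μ i • w) := by
      rw [hcw, map_add, map_smul, hμ]
      module
    have h3 : ⟪A w - μ i • w, e i⟫_ℂ = 0 :=
      horth i _ (Submodule.sub_mem _ (hinv i w hw) (Submodule.smul_mem _ _ hw))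
    rw [h2, inner_add_left, h3, add_zero, inner_smul_left, inner_self_eq_norm_sq_to_K, hon.1 i]
    simp
  have h := sum_norm_inner_le hA 1 1 hon Finset.univ
  rw [one_mul, mul_one] at h
  simp only [hdiag] at h
  refine h.trans (mul_le_of_le_one_left ENNReal.toReal_nonneg ?_)
  exact mul_le_one₀ ContinuousLinearMap.norm_id_le (norm_nonneg _) ContinuousLinearMap.norm_id_le

/-- For every `δ > 0` only finitely many points of the spectrum have modulus greater than `δ`,
because they are eigenvalues and the sum of their moduli is bounded. -/
theorem IsTraceClass.countable_spectrum {A : H →L[ℂ] H} (hA : IsTraceClass A) :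
    (spectrum ℂ A).Countable := by
  have hfin : ∀ δ : ℝ, 0 < δ → {z ∈ spectrum ℂ A | δ < ‖z‖}.Finite := by
    intro δ hδ
    by_contra hinf
    obtain ⟨n, hn⟩ := exists_nat_gt ((traceNorm A).toReal / δ)
    obtain ⟨s, hs, hcard⟩ := Set.Infinite.exists_subset_card_eq hinf n
    have hev : ∀ i : Fin n, ∃ v : H,
        Module.End.HasEigenvector (A : Module.End ℂ H) (s.equivFinOfCardEq hcard |>.symm i : ℂ) v :=
      fun i => by
        have hz := hs (s.equivFinOfCardEq hcard |>.symm i).2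
        exact ((hA.isCompactOperator.hasEigenvalue_iff_mem_spectrum
          (norm_pos_iff.1 (hδ.trans hz.2))).2 hz.1).exists_hasEigenvector
    choose v hv using hev
    have hli : LinearIndependent ℂ v := Module.End.eigenvectors_linearIndependent' _ _
      (Subtype.val_injective.comp (Equiv.injective _)) v hv
    have h := sum_norm_eigenvalue_le hA (fun i => (hv i).apply_eq_smul) hli
    have h2 : (n : ℝ) * δ ≤ ∑ i : Fin n, ‖(s.equivFinOfCardEq hcard |>.symm i : ℂ)‖ := by
      have := Finset.card_nsmul_le_sum (Finset.univ : Finset (Fin n))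
        (fun i => ‖(s.equivFinOfCardEq hcard |>.symm i : ℂ)‖) δ
        fun i _ => (hs (s.equivFinOfCardEq hcard |>.symm i).2).2.le
      simpa using this
    rw [div_lt_iff₀ hδ] at hn
    linarith
  have hsub : spectrum ℂ A ⊆ {0} ∪ ⋃ n : ℕ, {z ∈ spectrum ℂ A | 1 / ((n : ℝ) + 1) < ‖z‖} := by
    intro z hz
    by_cases h0 : z = 0
    · exact Or.inl h0
    · obtain ⟨n, hn⟩ := exists_nat_one_div_lt (norm_pos_iff.2 h0)
      exact Or.inr (Set.mem_iUnion.2 ⟨n, hz, hn⟩)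
  exact ((Set.countable_singleton 0).union (Set.countable_iUnion fun n =>
    (hfin _ Nat.one_div_pos_of_nat).countable)).mono hsub

end Compact

/-! ### Riesz projections in Banach algebras -/

section Riesz
open scoped Real
open Complex

section

variable {𝔸 : Type*} [NormedRing 𝔸]

/-- Growth of powers of a sum of commuting elements, by the binomial theorem. -/
theorem norm_add_pow_mul_mul_le {x y p q : 𝔸} {C D s : ℝ} (hxy : Commute x y) (hyp : Commute y p)
    (hC : 0 ≤ C) (hs : 0 ≤ s) (hx : ∀ n, ‖x ^ n * p‖ ≤ C * s ^ n)
    (hy : ∀ n, ‖y ^ n * q‖ ≤ D * s ^ n) (n : ℕ) :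
    ‖(x + y) ^ n * (p * q)‖ ≤ C * D * (2 * s) ^ n := by
  rw [hxy.add_pow, Finset.sum_mul]
  have hterm : ∀ k ∈ Finset.range (n + 1),
      ‖x ^ k * y ^ (n - k) * (n.choose k : 𝔸) * (p * q)‖ ≤ C * D * s ^ n * n.choose k := by
    intro k hk
    have h1 : x ^ k * y ^ (n - k) * (n.choose k : 𝔸) * (p * q) =
        n.choose k • ((x ^ k * p) * (y ^ (n - k) * q)) := by
      rw [nsmul_eq_mul, (Nat.cast_commute (n.choose k) (x ^ k * y ^ (n - k))).symm.eq, mul_assoc,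
        mul_assoc (x ^ k), mul_assoc (x ^ k), ← mul_assoc _ p q, (hyp.pow_left _).eq, mul_assoc p]
    rw [h1]
    refine (norm_nsmul_le).trans ?_
    rw [mul_comm _ (n.choose k : ℝ)]
    refine mul_le_mul_of_nonneg_left ((norm_mul_le _ _).trans ?_) (Nat.cast_nonneg _)
    calc _ ≤ (C * s ^ k) * (D * s ^ (n - k)) :=
          mul_le_mul (hx k) (hy _) (norm_nonneg _) (by positivity)
      _ = C * D * (s ^ k * s ^ (n - k)) := by ring
      _ = C * D * s ^ n := by
          rw [← pow_add, Nat.add_sub_cancel' (Nat.lt_succ_iff.1 (Finset.mem_range.1 hk))]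
  refine (norm_sum_le_of_le _ hterm).trans_eq ?_
  rw [← Finset.mul_sum, ← Nat.cast_sum, Nat.sum_range_choose, mul_pow]
  push_cast
  ring

/-- If `a` decays on `q` faster than its inverse powers `c` grow on `f`, then `f * q = 0`. -/
theorem mul_eq_zero_of_decay {a f q : 𝔸} {c : ℕ → 𝔸} {C D r s : ℝ} (hr : 0 < r) (hs : 0 ≤ s)
    (hsr : s < r) (hca : ∀ n, Commute (c n) a) (hc : ∀ n, ‖c n‖ ≤ C * (r ^ n)⁻¹)
    (hf : ∀ n, a ^ (n + 1) * c (n + 1) = f) (hq : ∀ n, ‖a ^ n * q‖ ≤ D * s ^ n) :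
    f * q = 0 := by
  have hC : 0 ≤ C := by simpa using (norm_nonneg _).trans (hc 0)
  have hbound : ∀ n, ‖f * q‖ ≤ C * D * (s / r) ^ (n + 1) := by
    intro n
    rw [← hf n, ← ((hca (n + 1)).pow_right _).eq, mul_assoc]
    refine (norm_mul_le _ _).trans ?_
    calc _ ≤ (C * (r ^ (n + 1))⁻¹) * (D * s ^ (n + 1)) :=
          mul_le_mul (hc _) (hq _) (norm_nonneg _) (by positivity)
      _ = _ := by rw [div_pow]; ring
  have hlim : Filter.Tendsto (fun n : ℕ => C * D * (s / r) ^ (n + 1)) Filter.atTop (𝓝 0) := by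
    have := (tendsto_pow_atTop_nhds_zero_of_lt_one (div_nonneg hs hr.le)
      ((div_lt_one hr).2 hsr)).comp (Filter.tendsto_add_atTop_nat 1)
    simpa using this.const_mul (C * D)
  exact norm_le_zero_iff.1 (ge_of_tendsto' hlim hbound)

end

theorem spectrum_sub_subset_of_comm {𝔹 : Type*} [NormedCommRing 𝔹] [NormedAlgebra ℂ 𝔹]
    [CompleteSpace 𝔹] (a b : 𝔹) :
    spectrum ℂ (a - b) ⊆ Set.image2 (· - ·) (spectrum ℂ a) (spectrum ℂ b) := by
  intro z hz
  obtain ⟨φ, rfl⟩ := WeakDual.CharacterSpace.mem_spectrum_iff_exists.1 hz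
  exact ⟨φ a, AlgHom.apply_mem_spectrum φ a, φ b, AlgHom.apply_mem_spectrum φ b,
    (map_sub φ a b).symm⟩

variable {𝔸 : Type*} [NormedRing 𝔸] [NormedAlgebra ℂ 𝔸]

theorem mul_resolvent {a : 𝔸} {z : ℂ} (hz : z ∈ resolventSet ℂ a) :
    a * resolvent a z = z • resolvent a z - 1 := by
  have h : (algebraMap ℂ 𝔸 z - a) * resolvent a z = 1 := Ring.mul_inverse_cancel _ hz
  rw [sub_mul, Algebra.algebraMap_eq_smul_one, smul_one_mul] at h
  rw [← h, sub_sub_cancel]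

/-- A countable set meets only countably many of the circles centered at `0`. -/
theorem exists_sphere_subset_resolventSet {a : 𝔸} (ha : (spectrum ℂ a).Countable) {ε : ℝ}
    (hε : 0 < ε) : ∃ r, 0 < r ∧ r < ε ∧ Metric.sphere (0 : ℂ) r ⊆ resolventSet ℂ a := by
  have h1 : ((fun z : ℂ => ‖z‖) '' spectrum ℂ a).Countable := ha.image _
  have h2 : ¬ (Set.Ioo 0 ε).Countable := fun h => by
    have := h.measure_zero MeasureTheory.volume
    rw [Real.volume_Ioo, sub_zero, ENNReal.ofReal_eq_zero] at this
    exact this.not_gt hε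
  obtain ⟨r, hr, hr'⟩ : ∃ r ∈ Set.Ioo 0 ε, r ∉ (fun z : ℂ => ‖z‖) '' spectrum ℂ a := by
    by_contra! hcon
    exact h2 (h1.mono hcon)
  refine ⟨r, hr.1, hr.2, fun z hz => ?_⟩
  by_contra hz'
  exact hr' ⟨z, hz', mem_sphere_zero_iff_norm.1 hz⟩

theorem commute_of_mem_elemental {a x y : 𝔸} (hx : x ∈ Algebra.elemental ℂ a) (hy : Commute y a) :
    Commute y x :=
  Subalgebra.mem_centralizer_iff ℂ |>.1
    (Algebra.elemental.le_centralizer_centralizer (R := ℂ) a hx) y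
    (Subalgebra.mem_centralizer_iff ℂ |>.2 fun z hz => by
      rw [Set.mem_singleton_iff.1 hz]
      exact hy.eq.symm)

variable [CompleteSpace 𝔸]

/-- The Laurent coefficient `∮ z ^ m (z - a)⁻¹ dz` of the resolvent along the circle `|z| = r`. -/
def laurentIntegral (a : 𝔸) (r : ℝ) (m : ℤ) : 𝔸 := ∮ z in C(0, r), z ^ m • resolvent a z

theorem continuousOn_zpow_smul_resolvent {a : 𝔸} {r : ℝ} (hr : 0 < r)
    (h : Metric.sphere (0 : ℂ) r ⊆ resolventSet ℂ a) (m : ℤ) :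
    ContinuousOn (fun z : ℂ => z ^ m • resolvent a z) (Metric.sphere 0 r) := by
  refine ContinuousOn.smul (fun z hz => ?_) fun z hz => ?_
  · exact (continuousAt_zpow₀ z m (Or.inl (Metric.ne_of_mem_sphere hz hr.ne'))).continuousWithinAt
  · exact (spectrum.hasDerivAt_resolvent_const_left (h hz)).continuousAt.continuousWithinAt

/-- Multiplication by `a` shifts the Laurent coefficients by one, by `mul_resolvent`; the scalar
correction `∮ z ^ m dz` is nonzero only for `m = -1`. -/
theorem mul_laurentIntegral {a : 𝔸} {r : ℝ} (hr : 0 < r)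
    (h : Metric.sphere (0 : ℂ) r ⊆ resolventSet ℂ a) (m : ℤ) :
    a * laurentIntegral a r m =
      laurentIntegral a r (m + 1) - if m = -1 then (2 * π * I) • (1 : 𝔸) else 0 := by
  have hint : ∀ m : ℤ, CircleIntegrable (fun z : ℂ => z ^ m • resolvent a z) 0 r := fun m =>
    (continuousOn_zpow_smul_resolvent hr h m).circleIntegrable hr.le
  have hpow : ContinuousOn (fun z : ℂ => z ^ m • (1 : 𝔸)) (Metric.sphere 0 r) := by
    refine ContinuousOn.smul (fun z hz => ?_) continuousOn_const
    exact (continuousAt_zpow₀ z m (Or.inl (Metric.ne_of_mem_sphere hz hr.ne'))).continuousWithinAt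
  have h1 : a * laurentIntegral a r m = ∮ z in C(0, r), a * (z ^ m • resolvent a z) := by
    unfold laurentIntegral circleIntegral
    have hI := (hint m).out
    rw [← ContinuousLinearMap.mul_apply' ℂ 𝔸, ← ContinuousLinearMap.intervalIntegral_comp_comm _ hI]
    refine intervalIntegral.integral_congr fun θ _ => ?_
    simp only [ContinuousLinearMap.mul_apply', mul_smul_comm]
  have h2 : (∮ z in C(0, r), a * (z ^ m • resolvent a z)) =
      ∮ z in C(0, r), (z ^ (m + 1) • resolvent a z - z ^ m • (1 : 𝔸)) := by
    refine circleIntegral.integral_congr hr.le fun z hz => ?_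
    rw [mul_smul_comm, mul_resolvent (h hz), smul_sub, smul_smul,
      ← zpow_add_one₀ (Metric.ne_of_mem_sphere hz hr.ne')]
  rw [h1, h2, circleIntegral.integral_sub (hint _) (hpow.circleIntegrable hr.le),
    circleIntegral.integral_smul_const]
  congr 1
  split_ifs with hm
  · rw [hm, ← circleIntegral.integral_sub_center_inv 0 hr.ne']
    simp
  · have := circleIntegral.integral_sub_zpow_of_ne hm 0 0 r
    simp only [sub_zero] at this
    rw [this, zero_smul]

theorem exists_norm_laurentIntegral_le {a : 𝔸} {r : ℝ} (hr : 0 < r)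
    (h : Metric.sphere (0 : ℂ) r ⊆ resolventSet ℂ a) :
    ∃ C : ℝ, 0 ≤ C ∧ ∀ m : ℤ, ‖laurentIntegral a r m‖ ≤ C * r ^ m := by
  have hc : ContinuousOn (fun z : ℂ => resolvent a z) (Metric.sphere 0 r) := by
    simpa using continuousOn_zpow_smul_resolvent hr h 0
  obtain ⟨M, hM⟩ := (isCompact_sphere (0 : ℂ) r).exists_bound_of_continuousOn hc
  have hM0 : 0 ≤ M := (norm_nonneg _).trans (hM r (by simp [hr.le]))
  refine ⟨2 * π * r * M, by positivity, fun m => ?_⟩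
  have := circleIntegral.norm_integral_le_of_norm_le_const (c := 0) (R := r)
    (f := fun z => z ^ m • resolvent a z) (C := r ^ m * M) hr.le fun z hz => by
      rw [norm_smul, norm_zpow, mem_sphere_zero_iff_norm.1 hz]
      exact mul_le_mul_of_nonneg_left (hM z hz) (zpow_nonneg hr.le _)
  refine this.trans_eq ?_
  ring

/-- The spectral splitting of `a` along the circle `|z| = r` in the resolvent set: `e` is the
Riesz projection of the part of the spectrum inside the circle, and `a` is invertible on the range
of `1 - e`, its inverse powers being given by `c`. -/
theorem exists_riesz_splitting {a : 𝔸} {r : ℝ} (hr : 0 < r)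
    (h : Metric.sphere (0 : ℂ) r ⊆ resolventSet ℂ a) :
    ∃ (e : 𝔸) (c : ℕ → 𝔸) (C : ℝ), 0 ≤ C ∧ (∀ n, ‖a ^ n * e‖ ≤ C * r ^ n) ∧
      (∀ n, ‖c n‖ ≤ C * (r ^ n)⁻¹) ∧ ∀ n, a ^ (n + 1) * c (n + 1) = 1 - e := by
  obtain ⟨C, hC0, hC⟩ := exists_norm_laurentIntegral_le hr h
  have hpos : ∀ n : ℕ, a ^ n * laurentIntegral a r 0 = laurentIntegral a r n := by
    intro n
    induction n with
    | zero => simp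
    | succ n ih =>
      rw [pow_succ', mul_assoc, ih, mul_laurentIntegral hr h, if_neg (by lia), sub_zero]
      simp
  have hneg : ∀ n : ℕ, a ^ (n + 1) * laurentIntegral a r (-(n + 1 : ℕ)) =
      laurentIntegral a r 0 - (2 * π * I) • (1 : 𝔸) := by
    intro n
    induction n with
    | zero =>
      rw [zero_add, pow_one, mul_laurentIntegral hr h, if_pos (by simp)]
      simp
    | succ n ih =>
      rw [pow_succ, mul_assoc, mul_laurentIntegral hr h, if_neg (by push_cast; lia), sub_zero,
        ← ih]
      congr 2
  set w : ℂ := (2 * π * I)⁻¹ with hw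
  refine ⟨w • laurentIntegral a r 0, fun n => -w • laurentIntegral a r (-(n : ℤ)), ‖w‖ * C,
    by positivity, fun n => ?_, fun n => ?_, fun n => ?_⟩
  · rw [mul_smul_comm, hpos, norm_smul, mul_assoc]
    exact mul_le_mul_of_nonneg_left (by simpa using hC n) (norm_nonneg _)
  · rw [norm_smul, norm_neg, mul_assoc]
    exact mul_le_mul_of_nonneg_left (by simpa using hC (-n)) (norm_nonneg _)
  · rw [mul_smul_comm, hneg, smul_sub, smul_smul, neg_mul, inv_mul_cancel₀ two_pi_I_ne_zero,
      neg_smul, neg_smul, one_smul]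
    abel

theorem isPreconnected_compl_of_countable {s : Set ℂ} (hs : s.Countable) : IsPreconnected sᶜ := by
  refine (hs.isConnected_compl_of_one_lt_rank ?_).isPreconnected
  rw [Complex.rank_real_complex]
  exact Nat.one_lt_ofNat

/-- Passing to a closed subalgebra can only fill holes of the spectrum, and a countable compact set
has none. -/
theorem spectrum_eq_of_countable (S : Subalgebra ℂ 𝔸) (hS : IsClosed (S : Set 𝔸)) (x : S)
    (hx : (spectrum ℂ (x : 𝔸)).Countable) : spectrum ℂ x = spectrum ℂ (x : 𝔸) :=
  Subalgebra.spectrum_eq_of_isPreconnected_compl (hS := hS) S x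
    (isPreconnected_compl_of_countable hx)

/-- The splitting of `exists_riesz_splitting` for an element with countable spectrum. Since the
complement of the spectrum is connected, it takes place in the closed algebra generated by `a`. -/
theorem exists_elemental_splitting {a : 𝔸} (ha : (spectrum ℂ a).Countable) {ε : ℝ} (hε : 0 < ε) :
    ∃ r, 0 < r ∧ r < ε ∧ ∃ (e : 𝔸) (c : ℕ → 𝔸) (C : ℝ), e ∈ Algebra.elemental ℂ a ∧
      (∀ n, c n ∈ Algebra.elemental ℂ a) ∧ 0 ≤ C ∧ (∀ n, ‖a ^ n * e‖ ≤ C * r ^ n) ∧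
      (∀ n, ‖c n‖ ≤ C * (r ^ n)⁻¹) ∧ ∀ n, a ^ (n + 1) * c (n + 1) = 1 - e := by
  obtain ⟨r, hr, hrε, hsub⟩ := exists_sphere_subset_resolventSet ha hε
  let a' : Algebra.elemental ℂ a := ⟨a, Algebra.elemental.self_mem ℂ a⟩
  have hspec : spectrum ℂ a' = spectrum ℂ a :=
    spectrum_eq_of_countable _ (Algebra.elemental.isClosed ℂ a) a' ha
  have hsub' : Metric.sphere (0 : ℂ) r ⊆ resolventSet ℂ a' := fun z hz => by
    have : z ∉ spectrum ℂ a' := by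
      rw [hspec]
      exact fun hz' => hz' (hsub hz)
    exact not_not.1 this
  obtain ⟨e, c, C, hC, he, hc, hec⟩ := exists_riesz_splitting hr hsub'
  exact ⟨r, hr, hrε, e, fun n => c n, C, e.2, fun n => (c n).2, hC, he, hc,
    fun n => congrArg Subtype.val (hec n)⟩

/-- In the closed commutative algebra generated by `a` and `b` the spectra of `a` and `b` do not
grow, and Gelfand theory applies to `a - b`. -/
theorem countable_spectrum_sub {a b : 𝔸} (hab : Commute a b) (ha : (spectrum ℂ a).Countable)
    (hb : (spectrum ℂ b).Countable) : (spectrum ℂ (a - b)).Countable := by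
  let S₀ : Subalgebra ℂ 𝔸 := Algebra.adjoin ℂ {a, b}
  have hcomm : ∀ x y : S₀, x * y = y * x := by
    refine (Algebra.isMulCommutative_adjoin ℂ (s := {a, b}) ?_).is_comm.comm
    rintro _ (rfl | rfl) _ (rfl | rfl)
    exacts [rfl, hab.eq, hab.eq.symm, rfl]
  let S := S₀.topologicalClosure
  have hS : IsClosed (S : Set 𝔸) := S₀.isClosed_topologicalClosure
  let _ : NormedCommRing S :=
    { (inferInstance : NormedRing S), S₀.commRingTopologicalClosure hcomm with }
  have : CompleteSpace S := hS.completeSpace_coe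
  let a' : S := ⟨a, S₀.le_topologicalClosure (Algebra.subset_adjoin (by simp))⟩
  let b' : S := ⟨b, S₀.le_topologicalClosure (Algebra.subset_adjoin (by simp))⟩
  have h1 : spectrum ℂ a' = spectrum ℂ a := spectrum_eq_of_countable S hS a' ha
  have h2 : spectrum ℂ b' = spectrum ℂ b := spectrum_eq_of_countable S hS b' hb
  have h3 := spectrum_sub_subset_of_comm a' b'
  rw [h1, h2] at h3
  exact ((ha.image2 hb _).mono h3).mono (spectrum.subset_subalgebra (a' - b'))

end Riesz

/-! ### Finite rank operators -/

section FiniteRank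
variable {H : Type*} [NormedAddCommGroup H] [InnerProductSpace ℂ H]

theorem IsFiniteRank.mul_right {P : H →L[ℂ] H} (hP : IsFiniteRank P) (G : H →L[ℂ] H) :
    IsFiniteRank (P * G) := by
  unfold IsFiniteRank at *
  exact Submodule.finiteDimensional_of_le (S₂ := LinearMap.range (P : H →ₗ[ℂ] H))
    (LinearMap.range_comp_le_range (G : H →ₗ[ℂ] H) (P : H →ₗ[ℂ] H))

theorem IsFiniteRank.mul_left {P : H →L[ℂ] H} (hP : IsFiniteRank P) (G : H →L[ℂ] H) :
    IsFiniteRank (G * P) := by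
  unfold IsFiniteRank at *
  have h : LinearMap.range ((G * P : H →L[ℂ] H) : H →ₗ[ℂ] H) =
      (LinearMap.range (P : H →ₗ[ℂ] H)).map (G : H →ₗ[ℂ] H) :=
    LinearMap.range_comp (P : H →ₗ[ℂ] H) (G : H →ₗ[ℂ] H)
  rw [h]
  infer_instance

theorem IsFiniteRank.add {P G : H →L[ℂ] H} (hP : IsFiniteRank P) (hG : IsFiniteRank G) :
    IsFiniteRank (P + G) := by
  unfold IsFiniteRank at *
  refine Submodule.finiteDimensional_of_le
    (S₂ := LinearMap.range (P : H →ₗ[ℂ] H) ⊔ LinearMap.range (G : H →ₗ[ℂ] H)) ?_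
  rintro _ ⟨x, rfl⟩
  exact Submodule.add_mem_sup ⟨x, rfl⟩ ⟨x, rfl⟩

/-- Up to a finite rank operator `1 - q` commuting with `A`, a trace class operator `A` has
arbitrarily small spectral radius. The range of `1 - q` lies in the kernel of the Riesz projection
`q'` of a smaller circle, where the compact operator `1 - q'` is the identity. -/
theorem exists_finiteRank_splitting [CompleteSpace H] {A : H →L[ℂ] H} (hA : IsTraceClass A) {ε : ℝ}
    (hε : 0 < ε) : ∃ s, 0 ≤ s ∧ s < ε ∧ ∃ (q : H →L[ℂ] H) (C : ℝ), 0 ≤ C ∧ Commute q A ∧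
      IsFiniteRank (1 - q) ∧ ∀ n, ‖A ^ n * q‖ ≤ C * s ^ n := by
  obtain ⟨r, hr, hrε, q, c, C, hq, hc, hC, hqn, hcn, hcq⟩ :=
    exists_elemental_splitting hA.countable_spectrum hε
  obtain ⟨r', hr', hrr', q', c', C', hq', hc', hC', hqn', hcn', hcq'⟩ :=
    exists_elemental_splitting hA.countable_spectrum hr
  have hqA : Commute q A := (commute_of_mem_elemental hq (Commute.refl A)).symm
  refine ⟨r, hr.le, hrε, q, C, hC, hqA, ?_, hqn⟩
  have h0 : (1 - q) * q' = 0 := mul_eq_zero_of_decay hr hr'.le hrr'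
    (fun n => (commute_of_mem_elemental (hc n) (Commute.refl A)).symm) hcn hcq hqn'
  have h0' : q' * (1 - q) = 0 := by
    have hcomm : Commute q q' := commute_of_mem_elemental hq' hqA
    rw [mul_sub, mul_one, ← hcomm.eq, ← h0, sub_mul, one_mul]
  have hK : IsCompactOperator (1 - q' : H →L[ℂ] H) := by
    rw [← hcq' 0, zero_add, pow_one]
    exact hA.isCompactOperator.comp_clm (c' 1)
  let K : Submodule ℂ H := LinearMap.ker (q' : H →ₗ[ℂ] H)
  have hid : ∀ x ∈ K, (1 - q' : H →L[ℂ] H) x = x := fun x hx => by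
    have hx' : q' x = 0 := hx
    rw [sub_apply, hx', sub_zero, one_apply_eq_self]
  have hmaps : ∀ x ∈ K, ((1 - q' : H →L[ℂ] H) : H →ₗ[ℂ] H) x ∈ K := fun x hx => by
    change (1 - q' : H →L[ℂ] H) x ∈ K
    rwa [hid x hx]
  have hrestr := IsCompactOperator.restrict (f := ((1 - q' : H →L[ℂ] H) : H →ₗ[ℂ] H)) hK hmaps
    q'.isClosed_ker
  have hfin : FiniteDimensional ℂ K := by
    refine FiniteDimensional.of_isCompactOperator_id (𝕜 := ℂ) ?_
    convert! hrestr using 1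
    ext x
    exact (hid x x.2).symm
  refine Submodule.finiteDimensional_of_le (S₂ := K) ?_
  rintro _ ⟨x, rfl⟩
  exact congrArg (fun T : H →L[ℂ] H => T x) h0'

end FiniteRank

/-! ### Two-sided multiplications -/

section Sandwich
variable {H : Type*} [NormedAddCommGroup H] [InnerProductSpace ℂ H] [CompleteSpace H]

/-- The map `X ↦ C X D` on the trace class operators. -/
def traceClassMul (C D : H →L[ℂ] H) : TraceClass H →L[ℂ] TraceClass H :=
  LinearMap.mkContinuous
    { toFun := fun X => ofOp (C * toOp H X * D) ((isTraceClass_toOp X).mul_mul C D)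
      map_add' := fun X Y => toOp_injective (by
        simp only [toOp_ofOp, map_add, mul_add, add_mul])
      map_smul' := fun c X => toOp_injective (by
        simp only [toOp_ofOp, map_smul, mul_smul_comm, smul_mul_assoc, RingHom.id_apply]) }
    (‖C‖ * ‖D‖) fun X => traceNorm_mul_mul_toReal_le (isTraceClass_toOp X) C D

theorem norm_traceClassMul_le (C D : H →L[ℂ] H) : ‖traceClassMul C D‖ ≤ ‖C‖ * ‖D‖ :=
  LinearMap.mkContinuous_norm_le _ (by positivity) _

variable (H) in
/-- Pairs of a bounded operator on the trace class operators, with the trace norm, and a bounded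
operator on the bounded operators, with the operator norm. Working in this Banach algebra treats
the two norms at once. -/
def PairAlgebra : Type _ :=
  (TraceClass H →L[ℂ] TraceClass H) × ((H →L[ℂ] H) →L[ℂ] (H →L[ℂ] H))

instance : NormedRing (PairAlgebra H) := inferInstanceAs (NormedRing
  ((TraceClass H →L[ℂ] TraceClass H) × ((H →L[ℂ] H) →L[ℂ] (H →L[ℂ] H))))

instance : NormedAlgebra ℂ (PairAlgebra H) := inferInstanceAs (NormedAlgebra ℂ
  ((TraceClass H →L[ℂ] TraceClass H) × ((H →L[ℂ] H) →L[ℂ] (H →L[ℂ] H))))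

instance : CompleteSpace (PairAlgebra H) := inferInstanceAs (CompleteSpace
  ((TraceClass H →L[ℂ] TraceClass H) × ((H →L[ℂ] H) →L[ℂ] (H →L[ℂ] H))))

theorem norm_snd_le_norm (p : PairAlgebra H) : ‖p.2‖ ≤ ‖p‖ := le_max_right _ _

theorem continuous_fst_pairAlgebra : Continuous fun p : PairAlgebra H => p.1 :=
  continuous_fst (X := TraceClass H →L[ℂ] TraceClass H)
    (Y := (H →L[ℂ] H) →L[ℂ] (H →L[ℂ] H))

theorem continuous_snd_pairAlgebra : Continuous fun p : PairAlgebra H => p.2 :=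
  continuous_snd (X := TraceClass H →L[ℂ] TraceClass H)
    (Y := (H →L[ℂ] H) →L[ℂ] (H →L[ℂ] H))

/-- The map `X ↦ C X D`, on the trace class operators and on the bounded operators. -/
def sandwich (C D : H →L[ℂ] H) : PairAlgebra H :=
  (traceClassMul C D, ContinuousLinearMap.mulLeftRight ℂ (H →L[ℂ] H) C D)

theorem sandwich_snd_apply (C D B : H →L[ℂ] H) : (sandwich C D).2 B = C * B * D := rfl

theorem toOp_sandwich_fst_apply (C D : H →L[ℂ] H) (X : TraceClass H) :
    toOp H ((sandwich C D).1 X) = C * toOp H X * D := rfl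

theorem pairAlgebra_ext {p q : PairAlgebra H} (h1 : ∀ X, toOp H (p.1 X) = toOp H (q.1 X))
    (h2 : ∀ B, p.2 B = q.2 B) : p = q :=
  Prod.ext (ContinuousLinearMap.ext fun X => toOp_injective (h1 X)) (ContinuousLinearMap.ext h2)

theorem sandwich_mul (C D C' D' : H →L[ℂ] H) :
    sandwich C D * sandwich C' D' = sandwich (C * C') (D' * D) := by
  refine pairAlgebra_ext (fun X => ?_) fun B => ?_
  · change C * (C' * toOp H X * D') * D = _
    rw [toOp_sandwich_fst_apply]
    simp only [mul_assoc]
  · change C * (C' * B * D') * D = _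
    rw [sandwich_snd_apply]
    simp only [mul_assoc]

theorem sandwich_one_one : sandwich (1 : H →L[ℂ] H) 1 = 1 := by
  refine pairAlgebra_ext (fun X => ?_) fun B => ?_
  · rw [toOp_sandwich_fst_apply, one_mul, mul_one]; rfl
  · rw [sandwich_snd_apply, one_mul, mul_one]; rfl

theorem sandwich_sub_left (C C' D : H →L[ℂ] H) :
    sandwich (C - C') D = sandwich C D - sandwich C' D := by
  refine pairAlgebra_ext (fun X => ?_) fun B => ?_
  · change (C - C') * _ * D = toOp H ((sandwich C D).1 X - (sandwich C' D).1 X)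
    rw [map_sub, toOp_sandwich_fst_apply, toOp_sandwich_fst_apply, sub_mul, sub_mul]
  · change (C - C') * _ * D = C * B * D - C' * B * D
    rw [sub_mul, sub_mul]

theorem sandwich_sub_right (C D D' : H →L[ℂ] H) :
    sandwich C (D - D') = sandwich C D - sandwich C D' := by
  refine pairAlgebra_ext (fun X => ?_) fun B => ?_
  · change C * _ * (D - D') = toOp H ((sandwich C D).1 X - (sandwich C D').1 X)
    rw [map_sub, toOp_sandwich_fst_apply, toOp_sandwich_fst_apply, mul_sub]
  · change C * _ * (D - D') = C * B * D - C * B * D'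
    rw [mul_sub]

theorem sandwich_smul_one_left (z : ℂ) : sandwich (z • (1 : H →L[ℂ] H)) 1 = z • 1 := by
  refine pairAlgebra_ext (fun X => ?_) fun B => ?_
  · change _ = toOp H (z • X)
    rw [toOp_sandwich_fst_apply, smul_one_mul, mul_one, map_smul]
  · rw [sandwich_snd_apply, smul_one_mul, mul_one]; rfl

theorem sandwich_smul_one_right (z : ℂ) : sandwich 1 (z • (1 : H →L[ℂ] H)) = z • 1 := by
  refine pairAlgebra_ext (fun X => ?_) fun B => ?_
  · change _ = toOp H (z • X)
    rw [toOp_sandwich_fst_apply, mul_smul_one, one_mul, map_smul]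
  · rw [sandwich_snd_apply, mul_smul_one, one_mul]; rfl

theorem norm_sandwich_le (C D : H →L[ℂ] H) : ‖sandwich C D‖ ≤ ‖C‖ * ‖D‖ :=
  max_le (norm_traceClassMul_le C D)
    (ContinuousLinearMap.opNorm_mulLeftRight_apply_apply_le _ _ C D)

theorem sandwich_left_pow (A : H →L[ℂ] H) (n : ℕ) : sandwich A 1 ^ n = sandwich (A ^ n) 1 := by
  induction n with
  | zero => rw [pow_zero, pow_zero, sandwich_one_one]
  | succ n ih => rw [pow_succ, ih, sandwich_mul, pow_succ, one_mul]

theorem sandwich_right_pow (A : H →L[ℂ] H) (n : ℕ) : sandwich 1 A ^ n = sandwich 1 (A ^ n) := by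
  induction n with
  | zero => rw [pow_zero, pow_zero, sandwich_one_one]
  | succ n ih => rw [pow_succ, ih, sandwich_mul, pow_succ', one_mul]

theorem commute_sandwich_left_right (C D : H →L[ℂ] H) :
    Commute (sandwich C 1) (sandwich 1 D) := by
  change _ * _ = _ * _
  rw [sandwich_mul, sandwich_mul, one_mul, one_mul, mul_one, mul_one]

theorem spectrum_sandwich_left_subset (A : H →L[ℂ] H) :
    spectrum ℂ (sandwich A 1) ⊆ spectrum ℂ A := by
  intro z hz hz'
  refine hz ?_
  obtain ⟨u, hu⟩ : IsUnit (algebraMap ℂ (H →L[ℂ] H) z - A) := hz'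
  refine ⟨⟨sandwich (u : H →L[ℂ] H) 1, sandwich (↑u⁻¹ : H →L[ℂ] H) 1, ?_, ?_⟩, ?_⟩
  · rw [sandwich_mul, u.mul_inv, one_mul, sandwich_one_one]
  · rw [sandwich_mul, u.inv_mul, one_mul, sandwich_one_one]
  · rw [Algebra.algebraMap_eq_smul_one] at hu ⊢
    change sandwich (u : H →L[ℂ] H) 1 = _
    rw [hu, sandwich_sub_left, sandwich_smul_one_left]

theorem spectrum_sandwich_right_subset (A : H →L[ℂ] H) :
    spectrum ℂ (sandwich 1 A) ⊆ spectrum ℂ A := by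
  intro z hz hz'
  refine hz ?_
  obtain ⟨u, hu⟩ : IsUnit (algebraMap ℂ (H →L[ℂ] H) z - A) := hz'
  refine ⟨⟨sandwich 1 (u : H →L[ℂ] H), sandwich 1 (↑u⁻¹ : H →L[ℂ] H), ?_, ?_⟩, ?_⟩
  · rw [sandwich_mul, u.inv_mul, one_mul, sandwich_one_one]
  · rw [sandwich_mul, u.mul_inv, one_mul, sandwich_one_one]
  · rw [Algebra.algebraMap_eq_smul_one] at hu ⊢
    change sandwich 1 (u : H →L[ℂ] H) = _
    rw [hu, sandwich_sub_right, sandwich_smul_one_right]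

/-- The map `X ↦ A X - X A`, on the trace class operators and on the bounded operators. -/
def adPair (A : H →L[ℂ] H) : PairAlgebra H := sandwich A 1 - sandwich 1 A

theorem adPair_snd_apply (A B : H →L[ℂ] H) : (adPair A).2 B = adOp A B := by
  change A * B * 1 - 1 * B * A = _
  rw [mul_one, one_mul, adOp_apply]

theorem toOp_adPair_fst_apply (A : H →L[ℂ] H) (X : TraceClass H) :
    toOp H ((adPair A).1 X) = adOp A (toOp H X) := by
  change toOp H ((sandwich A 1).1 X - (sandwich 1 A).1 X) = _
  rw [map_sub, toOp_sandwich_fst_apply, toOp_sandwich_fst_apply, mul_one, one_mul, adOp_apply]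

theorem countable_spectrum_adPair {A : H →L[ℂ] H} (hA : IsTraceClass A) :
    (spectrum ℂ (adPair A)).Countable :=
  countable_spectrum_sub (commute_sandwich_left_right A A)
    (hA.countable_spectrum.mono (spectrum_sandwich_left_subset A))
    (hA.countable_spectrum.mono (spectrum_sandwich_right_subset A))

theorem commute_sandwich_left_adPair {P A : H →L[ℂ] H} (h : Commute P A) :
    Commute (sandwich P 1) (adPair A) := by
  have h1 : Commute (sandwich P 1) (sandwich A 1) := by
    rw [Commute, SemiconjBy, sandwich_mul, sandwich_mul, h.eq]
  exact h1.sub_right (commute_sandwich_left_right P A)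

theorem commute_sandwich_right_adPair {P A : H →L[ℂ] H} (h : Commute P A) :
    Commute (sandwich 1 P) (adPair A) := by
  have h1 : Commute (sandwich 1 P) (sandwich 1 A) := by
    rw [Commute, SemiconjBy, sandwich_mul, sandwich_mul, h.eq]
  exact (commute_sandwich_left_right A P).symm.sub_right h1

/-- If `Aⁿ q = O(sⁿ)`, then the powers of `ad A` on the operators `q B q` are `O((2 s)ⁿ)`. -/
theorem norm_adPair_pow_mul_le {A q : H →L[ℂ] H} {D s : ℝ} (hD : 0 ≤ D) (hs : 0 ≤ s)
    (hqA : Commute q A) (hqn : ∀ n, ‖A ^ n * q‖ ≤ D * s ^ n) (n : ℕ) :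
    ‖adPair A ^ n * (sandwich q 1 * sandwich 1 q)‖ ≤ D * D * (2 * s) ^ n := by
  have h1 : ∀ n, ‖sandwich A 1 ^ n * sandwich q 1‖ ≤ D * s ^ n := fun n => by
    rw [sandwich_left_pow, sandwich_mul, one_mul]
    exact (norm_sandwich_le _ _).trans ((mul_le_of_le_one_right (norm_nonneg _)
      ContinuousLinearMap.norm_id_le).trans (hqn n))
  have h2 : ∀ n, ‖(-sandwich 1 A) ^ n * sandwich 1 q‖ ≤ D * s ^ n := fun n => by
    have : ‖(-sandwich 1 A) ^ n * sandwich 1 q‖ = ‖sandwich 1 A ^ n * sandwich 1 q‖ := by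
      rcases neg_one_pow_eq_or (PairAlgebra H) n with h | h
      · rw [neg_pow, h, one_mul]
      · rw [neg_pow, h, neg_one_mul, neg_mul, norm_neg]
    rw [this, sandwich_right_pow, sandwich_mul, one_mul, (hqA.pow_right n).eq]
    exact (norm_sandwich_le _ _).trans ((mul_le_of_le_one_left (norm_nonneg _)
      ContinuousLinearMap.norm_id_le).trans (hqn n))
  have h3 : adPair A = sandwich A 1 + -sandwich 1 A := sub_eq_add_neg _ _
  rw [h3]
  exact norm_add_pow_mul_mul_le (commute_sandwich_left_right A A).neg_right
    (commute_sandwich_left_right q A).symm.neg_left hD hs h1 h2 n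

/-- The spectral projection of `ad A` outside of a small disk takes values in the finite rank
operators: in `B = (1 - q) B + q B (1 - q) + q B q` only `q B q` need not have finite rank, and on
operators of this form `ad A` has small spectral radius. -/
theorem exists_adPair_splitting {A : H →L[ℂ] H} (hA : IsTraceClass A) {ε : ℝ} (hε : 0 < ε) :
    ∃ r, 0 < r ∧ r < ε ∧ ∃ (e : PairAlgebra H) (C : ℝ), 0 ≤ C ∧
      e ∈ Algebra.elemental ℂ (adPair A) ∧ (∀ n, ‖adPair A ^ n * e‖ ≤ C * r ^ n) ∧
      ∀ B, IsFiniteRank (B - e.2 B) := by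
  obtain ⟨r, hr, hrε, e, c, C, he, hc, hC, hen, hcn, hce⟩ :=
    exists_elemental_splitting (countable_spectrum_adPair hA) hε
  refine ⟨r, hr, hrε, e, C, hC, he, hen, fun B => ?_⟩
  obtain ⟨s, hs, hsr, q, D, hD, hqA, hfin, hqn⟩ := exists_finiteRank_splitting hA (half_pos hr)
  have hdecay := norm_adPair_pow_mul_le hD hs hqA hqn
  have hzero : (1 - e) * (sandwich q 1 * sandwich 1 q) = 0 :=
    mul_eq_zero_of_decay hr (by positivity) (by linarith)
      (fun n => (commute_of_mem_elemental (hc n) (Commute.refl _)).symm) hcn hce hdecay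
  have hP : Commute (1 - q) A := (Commute.one_left A).sub_left hqA
  set G := (1 - e).2 with hG
  have hG1 : ∀ X, G ((1 - q) * X) = (1 - q) * G X := fun X => by
    have h : Commute (sandwich (1 - q) 1) (1 - e) :=
      (Commute.one_right _).sub_right
        (commute_of_mem_elemental he (commute_sandwich_left_adPair hP))
    have h' := congrArg (fun p : PairAlgebra H => p.2 X) h.eq
    change (1 - q) * G X * 1 = G ((1 - q) * X * 1) at h'
    rw [mul_one, mul_one] at h'
    exact h'.symm
  have hG2 : ∀ X, G (X * (1 - q)) = G X * (1 - q) := fun X => by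
    have h : Commute (sandwich 1 (1 - q)) (1 - e) :=
      (Commute.one_right _).sub_right
        (commute_of_mem_elemental he (commute_sandwich_right_adPair hP))
    have h' := congrArg (fun p : PairAlgebra H => p.2 X) h.eq
    change 1 * G X * (1 - q) = G (1 * X * (1 - q)) at h'
    rw [one_mul, one_mul] at h'
    exact h'.symm
  have hG3 : G (q * B * q) = 0 := by
    have h' := congrArg (fun p : PairAlgebra H => p.2 B) hzero
    change G (q * (1 * B * q) * 1) = 0 at h'
    rwa [mul_one, one_mul, ← mul_assoc] at h'
  have hB : B = (1 - q) * B + (q * B * (1 - q) + q * B * q) := by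
    noncomm_ring
  have hGB : G B = (1 - q) * G B + G (q * B) * (1 - q) := by
    conv_lhs => rw [hB, map_add, map_add, hG1, hG2, hG3, add_zero]
  change IsFiniteRank (G B)
  rw [hGB]
  exact (hfin.mul_right _).add (hfin.mul_left _)

end Sandwich

/-! ### Invariance of trace norm closed subspaces -/

section Preserve
variable {H : Type*} [NormedAddCommGroup H] [InnerProductSpace ℂ H] [CompleteSpace H]

theorem isClosed_preimage_toOp {S : Set (H →L[ℂ] H)} (hS : IsTraceNormClosed S) :
    IsClosed (toOp H ⁻¹' S) := by
  refine isClosed_of_closure_subset fun X hX => ?_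
  refine hS _ (isTraceClass_toOp X) fun ε hε => ?_
  obtain ⟨Y, hY, hXY⟩ := EMetric.mem_closure_iff.1 hX ε hε
  refine ⟨toOp H Y, hY, ?_⟩
  rwa [edist_dist, dist_eq_norm, norm_eq_traceNorm,
    ENNReal.ofReal_toReal (isTraceClass_toOp _).ne, map_sub] at hXY

/-- The pairs that agree on the trace class operators and preserve the subspace `M`. -/
def preservingSubalgebra (M : Submodule ℂ (H →L[ℂ] H)) : Subalgebra ℂ (PairAlgebra H) where
  carrier := {p | ∀ X, toOp H (p.1 X) = p.2 (toOp H X) ∧ (toOp H X ∈ M → toOp H (p.1 X) ∈ M)}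
  mul_mem' {p q} hp hq X := by
    change toOp H (p.1 (q.1 X)) = p.2 (q.2 (toOp H X)) ∧ (_ → toOp H (p.1 (q.1 X)) ∈ M)
    exact ⟨by rw [(hp _).1, (hq _).1], fun hX => (hp _).2 ((hq _).2 hX)⟩
  add_mem' {p q} hp hq X := by
    change toOp H (p.1 X + q.1 X) = p.2 (toOp H X) + q.2 (toOp H X) ∧
      (_ → toOp H (p.1 X + q.1 X) ∈ M)
    rw [map_add, (hp _).1, (hq _).1]
    exact ⟨rfl, fun hX => (hp X).1 ▸ (hq X).1 ▸ M.add_mem ((hp X).2 hX) ((hq X).2 hX)⟩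
  algebraMap_mem' z X := by
    rw [Algebra.algebraMap_eq_smul_one]
    change toOp H (z • X) = z • toOp H X ∧ (_ → toOp H (z • X) ∈ M)
    rw [map_smul]
    exact ⟨rfl, fun hX => M.smul_mem z hX⟩

theorem isClosed_preservingSubalgebra {M : Submodule ℂ (H →L[ℂ] H)}
    (hM : IsTraceNormClosed (M : Set (H →L[ℂ] H))) :
    IsClosed (preservingSubalgebra M : Set (PairAlgebra H)) := by
  have h1 : ∀ X : TraceClass H, Continuous fun p : PairAlgebra H => p.1 X := fun X =>
    (ContinuousLinearMap.apply ℂ (TraceClass H) X).continuous.comp continuous_fst_pairAlgebra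
  have h2 : ∀ B : H →L[ℂ] H, Continuous fun p : PairAlgebra H => p.2 B := fun B =>
    (ContinuousLinearMap.apply ℂ (H →L[ℂ] H) B).continuous.comp continuous_snd_pairAlgebra
  have : (preservingSubalgebra M : Set (PairAlgebra H)) =
      ⋂ X, ({p | toOp H (p.1 X) = p.2 (toOp H X)} ∩ {p | toOp H X ∈ M → toOp H (p.1 X) ∈ M}) := by
    ext p
    simp only [Set.mem_iInter]
    rfl
  rw [this]
  refine isClosed_iInter fun X => IsClosed.inter ?_ ?_
  · exact isClosed_eq ((toOp H).continuous.comp (h1 X)) (h2 _)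
  · by_cases hX : toOp H X ∈ M
    · simp only [hX, true_imp_iff]
      exact (isClosed_preimage_toOp hM).preimage (h1 X)
    · simp [hX]

/-- The closed algebra generated by `ad A` preserves every trace norm closed subspace that `ad A`
preserves. -/
theorem snd_mem_of_mem_elemental {M : Submodule ℂ (H →L[ℂ] H)}
    (hM : IsTraceNormClosed (M : Set (H →L[ℂ] H))) (htr : ∀ B ∈ M, IsTraceClass B)
    {A : H →L[ℂ] H} (hA : ∀ B ∈ M, adOp A B ∈ M) {p : PairAlgebra H}
    (hp : p ∈ Algebra.elemental ℂ (adPair A)) {B : H →L[ℂ] H} (hB : B ∈ M) : p.2 B ∈ M := by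
  have hle : Algebra.elemental ℂ (adPair A) ≤ preservingSubalgebra M := by
    refine Algebra.elemental.le_of_mem (isClosed_preservingSubalgebra hM) fun X => ?_
    rw [toOp_adPair_fst_apply, adPair_snd_apply]
    exact ⟨rfl, hA _⟩
  have h := hle hp (ofOp B (htr B hB))
  rw [toOp_ofOp] at h
  rw [← h.1]
  exact h.2 hB

end Preserve

/-! ### Quasinilpotence of the adjoint action -/

section Engel
variable {H : Type*} [NormedAddCommGroup H] [InnerProductSpace ℂ H] [CompleteSpace H]

/-- The sum `s = ∑ z⁻ⁿ⁻¹ aⁿ e` inverts `z - a` on the range of `e`, if the powers of `a` decay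
there fast enough. -/
theorem exists_resolvent_mul {𝔸 : Type*} [NormedRing 𝔸] [NormedAlgebra ℂ 𝔸] [CompleteSpace 𝔸]
    {a e : 𝔸} {C r : ℝ} {z : ℂ} (hr : 0 ≤ r) (hrz : r < ‖z‖)
    (he : e ∈ Algebra.elemental ℂ a) (hen : ∀ n, ‖a ^ n * e‖ ≤ C * r ^ n) :
    ∃ s ∈ Algebra.elemental ℂ a, (z • 1 - a) * s = e ∧ s * (z • 1 - a) = e := by
  have hz : z ≠ 0 := norm_pos_iff.1 (hr.trans_lt hrz)
  let v : ℕ → 𝔸 := fun n => (z⁻¹) ^ (n + 1) • (a ^ n * e)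
  have hvmem : ∀ n, v n ∈ Algebra.elemental ℂ a := fun n => Subalgebra.smul_mem _
    (Subalgebra.mul_mem _ (Subalgebra.pow_mem _ (Algebra.elemental.self_mem ℂ a) n) he) _
  have hv : Summable v := by
    refine Summable.of_norm_bounded (g := fun n => ‖z‖⁻¹ * C * (r / ‖z‖) ^ n)
      ((summable_geometric_of_lt_one (by positivity)
        ((div_lt_one (hr.trans_lt hrz)).2 hrz)).mul_left _) fun n => ?_
    rw [norm_smul, norm_pow, norm_inv]
    calc _ ≤ ‖z‖⁻¹ ^ (n + 1) * (C * r ^ n) := by gcongr; exact hen n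
      _ = _ := by rw [div_pow, pow_succ, inv_pow]; ring
  have hs : ∑' n, v n ∈ Algebra.elemental ℂ a :=
    tsum_mem (Algebra.elemental.isClosed ℂ a) hvmem
  have hmul : (z • 1 - a) * ∑' n, v n = e := by
    -- `a v n = z v (n + 1)`, so the product telescopes.
    have hshift : ∀ n, a * v n = z • v (n + 1) := fun n => by
      simp only [v]
      rw [mul_smul_comm, smul_smul, ← mul_assoc, ← pow_succ', pow_succ' _ (n + 1), ← mul_assoc,
        mul_inv_cancel₀ hz, one_mul]
    rw [sub_mul, smul_one_mul, ← hv.tsum_mul_left]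
    simp only [hshift]
    rw [((summable_nat_add_iff 1).2 hv).tsum_const_smul, ← smul_sub, hv.tsum_eq_zero_add,
      add_sub_cancel_right]
    simp [v, smul_smul, hz]
  refine ⟨_, hs, hmul, ?_⟩
  have hc : Commute (z • 1 - a) (∑' n, v n) := commute_of_mem_elemental hs
    (((Commute.one_left a).smul_left z).sub_left (Commute.refl a))
  rw [← hc.eq, hmul]

theorem coe_adRestrict_pow_apply (L : LieSubalgebra ℂ (H →L[ℂ] H)) (A : L) (n : ℕ)
    (B : L.toSubmodule) :
    ((adRestrict L A ^ n) B : H →L[ℂ] H) = (adPair (A : H →L[ℂ] H) ^ n).2 B := by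
  induction n generalizing B with
  | zero => rfl
  | succ n ih =>
    rw [pow_succ, pow_succ]
    change ((adRestrict L A ^ n) (adRestrict L A B) : H →L[ℂ] H) =
      (adPair (A : H →L[ℂ] H) ^ n).2 ((adPair (A : H →L[ℂ] H)).2 B)
    rw [ih, adPair_snd_apply]
    rfl

theorem isEngel_or_exists_isFiniteRank (L : LieSubalgebra ℂ (H →L[ℂ] H))
    (htrace : ∀ A ∈ L, IsTraceClass A)
    (hclosed : IsTraceNormClosed (L : Set (H →L[ℂ] H))) :
    IsEngel L ∨ ∃ F ∈ L, F ≠ 0 ∧ IsFiniteRank F := by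
  by_cases hF : ∃ F ∈ L, F ≠ 0 ∧ IsFiniteRank F
  · exact Or.inr hF
  refine Or.inl fun A => ?_
  have hA := htrace A A.2
  have hpres : ∀ p ∈ Algebra.elemental ℂ (adPair (A : H →L[ℂ] H)), ∀ B ∈ L, p.2 B ∈ L :=
    fun p hp B hB => snd_mem_of_mem_elemental (M := L.toSubmodule) hclosed htrace
      (fun B hB => L.lie_mem A.2 hB) hp hB
  -- The spectral projection outside of a small disk vanishes on `L`.
  have hsplit : ∀ ε : ℝ, 0 < ε → ∃ r, 0 < r ∧ r < ε ∧ ∃ (e : PairAlgebra H) (C : ℝ), 0 ≤ C ∧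
      e ∈ Algebra.elemental ℂ (adPair (A : H →L[ℂ] H)) ∧
      (∀ n, ‖adPair (A : H →L[ℂ] H) ^ n * e‖ ≤ C * r ^ n) ∧ ∀ B ∈ L, e.2 B = B := by
    intro ε hε
    obtain ⟨r, hr, hrε, e, C, hC, he, hen, hfin⟩ := exists_adPair_splitting hA hε
    refine ⟨r, hr, hrε, e, C, hC, he, hen, fun B hB => ?_⟩
    by_contra hne
    exact hF ⟨B - e.2 B, sub_mem hB (hpres e he B hB), fun h => hne (sub_eq_zero.1 h).symm, hfin B⟩
  constructor
  · intro z hz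
    by_contra hz0
    refine hz ?_
    obtain ⟨r, hr, hrz, e, C, -, he, hen, heL⟩ := hsplit ‖z‖ (norm_pos_iff.2 hz0)
    obtain ⟨s, hs, hs1, hs2⟩ := exists_resolvent_mul hr.le hrz he hen
    let W : L.toSubmodule →L[ℂ] L.toSubmodule :=
      (s.2.comp L.toSubmodule.subtypeL).codRestrict L.toSubmodule fun B => hpres s hs B B.2
    have hcoe : ∀ B : L.toSubmodule,
        (((algebraMap ℂ (L.toSubmodule →L[ℂ] L.toSubmodule) z - adRestrict L A) B :
          L.toSubmodule) : H →L[ℂ] H) = (z • 1 - adPair (A : H →L[ℂ] H)).2 B := fun B => by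
      rw [Algebra.algebraMap_eq_smul_one]
      change z • (B : H →L[ℂ] H) - adOp (A : H →L[ℂ] H) B =
        z • (B : H →L[ℂ] H) - (adPair (A : H →L[ℂ] H)).2 B
      rw [adPair_snd_apply]
    refine isUnit_iff_exists.2 ⟨W, ?_, ?_⟩
    · refine ContinuousLinearMap.ext fun B => Subtype.ext ?_
      change ((algebraMap ℂ (L.toSubmodule →L[ℂ] L.toSubmodule) z - adRestrict L A) (W B) :
        H →L[ℂ] H) = B
      rw [hcoe]
      have h := congrArg (fun p : PairAlgebra H => p.2 (B : H →L[ℂ] H)) hs1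
      exact h.trans (heL B B.2)
    · refine ContinuousLinearMap.ext fun B => Subtype.ext ?_
      change s.2 ((algebraMap ℂ (L.toSubmodule →L[ℂ] L.toSubmodule) z - adRestrict L A) B :
        H →L[ℂ] H) = B
      rw [hcoe]
      have h := congrArg (fun p : PairAlgebra H => p.2 (B : H →L[ℂ] H)) hs2
      exact h.trans (heL B B.2)
  · rw [Metric.tendsto_atTop']
    intro ε hε
    obtain ⟨r, hr, hrε, e, C, hC, he, hen, heL⟩ := hsplit ε hε
    have hbound : ∀ n, ‖adRestrict L A ^ n‖ ≤ (C + 1) * r ^ n := fun n => by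
      refine ContinuousLinearMap.opNorm_le_bound _ (by positivity) fun B => ?_
      change ‖((adRestrict L A ^ n) B : H →L[ℂ] H)‖ ≤ _ * ‖(B : H →L[ℂ] H)‖
      rw [coe_adRestrict_pow_apply]
      have h1 : (adPair (A : H →L[ℂ] H) ^ n).2 (B : H →L[ℂ] H) =
          (adPair (A : H →L[ℂ] H) ^ n * e).2 B := by
        change _ = (adPair (A : H →L[ℂ] H) ^ n).2 (e.2 B)
        rw [heL B B.2]
      rw [h1]
      refine (ContinuousLinearMap.le_opNorm _ _).trans ?_
      refine mul_le_mul_of_nonneg_right ?_ (norm_nonneg _)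
      refine (norm_snd_le_norm _).trans ((hen n).trans ?_)
      exact mul_le_mul_of_nonneg_right (by linarith) (by positivity)
    have hlim : Filter.Tendsto (fun n : ℕ => (C + 1) ^ (1 / (n : ℝ)) * r) Filter.atTop
        (nhds r) := by
      have h0 : Filter.Tendsto (fun n : ℕ => 1 / (n : ℝ)) Filter.atTop (nhds 0) :=
        tendsto_one_div_atTop_nhds_zero_nat
      have hC1 : C + 1 ≠ 0 := by positivity
      have := ((Real.continuousAt_const_rpow hC1).tendsto.comp h0).mul_const r
      simpa using this
    -- `‖(ad A)ⁿ‖ ^ (1 / n) ≤ (C + 1) ^ (1 / n) * r`, which tends to `r < ε`.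
    obtain ⟨N, hN⟩ := Filter.eventually_atTop.1 (hlim.eventually_lt_const hrε)
    refine ⟨N, fun n hn => ?_⟩
    have hn0 : n ≠ 0 := by lia
    rw [Real.dist_eq, sub_zero, abs_of_nonneg (by positivity)]
    refine lt_of_le_of_lt ?_ (hN n hn.le)
    calc ‖adRestrict L A ^ n‖ ^ (1 / (n : ℝ)) ≤ ((C + 1) * r ^ n) ^ (1 / (n : ℝ)) :=
          Real.rpow_le_rpow (ContinuousLinearMap.opNorm_nonneg _) (hbound n) (by positivity)
      _ = (C + 1) ^ (1 / (n : ℝ)) * r := by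
          rw [Real.mul_rpow (by positivity) (by positivity), one_div,
            Real.pow_rpow_inv_natCast hr.le hn0]

end Engel

end TraceClassLie

end

theorem mainTheorem5 {H : Type*} [NormedAddCommGroup H] [InnerProductSpace ℂ H] [CompleteSpace H]
    (L : LieSubalgebra ℂ (H →L[ℂ] H))
    (htrace : ∀ A ∈ L, TraceClassLie.IsTraceClass A)
    (hclosed : TraceClassLie.IsTraceNormClosed (L : Set (H →L[ℂ] H))) :
    TraceClassLie.IsEngel L ∨ ∃ F ∈ L, F ≠ 0 ∧ TraceClassLie.IsFiniteRank F :=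
  TraceClassLie.isEngel_or_exists_isFiniteRank L htrace hclosed
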